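/- Let $M$ be a $4$-dimensional $1+1+2$ decomposed spacetime: a smooth manifold with a smooth Lorentzian metric $g$, a smooth unit timelike vector field $u^\mu$ and a smooth unit spacelike vector field $e^\mu$ orthogonal to $u^\mu$; put $N_{\mu\nu}=g_{\mu\nu}+u_\mu u_\nu-e_\mu e_\nu$. Let $\mathcal{T}$ be a smoothly embedded $3$-dimensional spacelike hypersurface of $M$ orthogonal to $u^\mu$, with induced metric $h_{\mu\nu}=N_{\mu\nu}+e_\mu e_\nu$ and Levi-Civita connection $D$, whose Ricci tensor has the form $$R'_{\mu\nu}=\alpha\, e_\mu e_\nu+\beta\, N_{\mu\nu}$$ for some functions $\alpha,\beta$ on $\mathcal{T}$. For a function $\psi$ on $\mathcal{T}$ write $\hat\psi=e^\mu D_\mu\psi$ and $\delta_\mu\psi=N_\mu{}^\nu D_\nu\psi$. Let $\tilde h_{\mu\nu}=e^{2\varphi}h_{\mu\nu}$ be a proper conformal transformation of $h$, i.e. $\varphi$ is not constant, where $\varphi$ is at least $C^2$ and constant on the $2$-sheets, $\delta_\mu\varphi=0$. Assume that the scalar curvature $\tilde R'$ of $\tilde h$ is constant and non-negative, that $$\hat\varphi^2+2\hat{\hat\varphi}>0$$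 everywhere on $\mathcal{T}$, and that the covariant derivatives $D_{\mu_1}\cdots D_{\mu_n}\varphi$ of all orders $n\ge 3$ exist and vanish. Then, everywhere on $\mathcal{T}$, $$\hat{\hat\varphi}\le 0\qquad\text{and}\qquad \hat\varphi^2>|\hat{\hat\varphi}|.$$ -/

import Mathlib

open scoped Manifold ContDiff

noncomputable section

namespace SplitSpacetime

/-- The model space of a hypersurface. -/
abbrev E3 : Type := EuclideanSpace ℝ (Fin 3)

/-- The model space of a spacetime. -/
abbrev E4 : Type := EuclideanSpace ℝ (Fin 4)

/-- A `1+1+2` decomposed spacetime: a smooth Lorentzian metric `g` (signature `-+++`), a smooth unit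
timelike field `u`, and a smooth unit spacelike field `e` orthogonal to `u`. -/
structure Decomposition (M : Type*) [TopologicalSpace M] [ChartedSpace E4 M]
    [IsManifold (𝓡 4) ∞ M] where
  /-- the Lorentzian metric -/
  g : ∀ p : M, TangentSpace (𝓡 4) p →L[ℝ] TangentSpace (𝓡 4) p →L[ℝ] ℝ
  g_smooth : ContMDiff (𝓡 4) ((𝓡 4).prod 𝓘(ℝ, E4 →L[ℝ] E4 →L[ℝ] ℝ)) ∞
    (fun p ↦ Bundle.TotalSpace.mk' (E4 →L[ℝ] E4 →L[ℝ] ℝ)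
      (E := fun p : M ↦ TangentSpace (𝓡 4) p →L[ℝ] TangentSpace (𝓡 4) p →L[ℝ] ℝ) p (g p))
  g_symm : ∀ (p : M) (v w : TangentSpace (𝓡 4) p), g p v w = g p w v
  /-- the observers' velocity -/
  u : ∀ p : M, TangentSpace (𝓡 4) p
  u_smooth : ContMDiff (𝓡 4) (𝓡 4).tangent ∞ (fun p ↦ (⟨p, u p⟩ : TangentBundle (𝓡 4) M))
  u_unit : ∀ p : M, g p (u p) (u p) = -1
  pos_of_orthogonal : ∀ (p : M) (v : TangentSpace (𝓡 4) p), g p (u p) v = 0 → v ≠ 0 → 0 < g p v v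
  /-- the preferred spatial direction -/
  e : ∀ p : M, TangentSpace (𝓡 4) p
  e_smooth : ContMDiff (𝓡 4) (𝓡 4).tangent ∞ (fun p ↦ (⟨p, e p⟩ : TangentBundle (𝓡 4) M))
  e_unit : ∀ p : M, g p (e p) (e p) = 1
  u_e : ∀ p : M, g p (u p) (e p) = 0

/-- The sheet metric `N_{μν} = g_{μν} + u_μ u_ν - e_μ e_ν`. -/
def Decomposition.N {M : Type*} [TopologicalSpace M] [ChartedSpace E4 M] [IsManifold (𝓡 4) ∞ M]
    (S : Decomposition M) (p : M) (v w : TangentSpace (𝓡 4) p) : ℝ :=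
  S.g p v w + S.g p (S.u p) v * S.g p (S.u p) w - S.g p (S.e p) v * S.g p (S.e p) w

/-- `T` as a smoothly embedded spacelike hypersurface orthogonal to `u`, with its induced metric
`h = ι^* g` (equivalently `h_{μν} = N_{μν} + e_μ e_ν`). The field `e` of the spacetime is then
tangent to `T`, and is regarded as a vector field on `T`. -/
structure Hypersurface {M : Type*} [TopologicalSpace M] [ChartedSpace E4 M]
    [IsManifold (𝓡 4) ∞ M] (S : Decomposition M)
    (T : Type*) [TopologicalSpace T] [ChartedSpace E3 T] [IsManifold (𝓡 3) ∞ T] where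
  /-- the inclusion -/
  ι : T → M
  isSmoothEmbedding : Manifold.IsSmoothEmbedding (𝓡 3) (𝓡 4) ∞ ι
  orthogonal_u : ∀ (p : T) (v : TangentSpace (𝓡 3) p),
    S.g (ι p) (S.u (ι p)) (mfderiv (𝓡 3) (𝓡 4) ι p v) = 0
  /-- the induced metric -/
  h : Bundle.ContMDiffRiemannianMetric (𝓡 3) ∞ E3 (fun p : T ↦ TangentSpace (𝓡 3) p)
  h_eq : ∀ (p : T) (v w : TangentSpace (𝓡 3) p),
    h.inner p v w = S.g (ι p) (mfderiv (𝓡 3) (𝓡 4) ι p v) (mfderiv (𝓡 3) (𝓡 4) ι p w)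
  /-- the preferred spatial direction, as a vector field on the hypersurface -/
  e : ∀ p : T, TangentSpace (𝓡 3) p
  e_smooth : ContMDiff (𝓡 3) (𝓡 3).tangent ∞ (fun p ↦ (⟨p, e p⟩ : TangentBundle (𝓡 3) T))
  e_eq : ∀ p : T, mfderiv (𝓡 3) (𝓡 4) ι p (e p) = S.e (ι p)

section Charts

variable {T : Type*} [TopologicalSpace T] [ChartedSpace E3 T]

/-- The coordinate vector field `∂_i` of the chart `c`, at the point with coordinates `x`. -/
def coordVec (c : OpenPartialHomeomorph T E3) (i : Fin 3) (x : E3) :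
    TangentSpace (𝓡 3) (c.symm x) :=
  mfderiv 𝓘(ℝ, E3) (𝓡 3) c.symm x (EuclideanSpace.single i (1 : ℝ))

/-- The partial derivative `∂_i F` of a function of the coordinates. -/
def partialDeriv (i : Fin 3) (F : E3 → ℝ) (x : E3) : ℝ :=
  fderiv ℝ F x (EuclideanSpace.single i (1 : ℝ))

variable (g : ∀ p : T, TangentSpace (𝓡 3) p →L[ℝ] TangentSpace (𝓡 3) p →L[ℝ] ℝ)
  (c : OpenPartialHomeomorph T E3)

/-- The matrix `g_{ij}` of a metric `g` in the chart `c`. -/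
def metricMatrix (x : E3) : Matrix (Fin 3) (Fin 3) ℝ :=
  Matrix.of fun i j ↦ g (c.symm x) (coordVec c i x) (coordVec c j x)

/-- The Christoffel symbols `Γ^k_{ij} = (1/2) g^{kl} (∂_i g_{jl} + ∂_j g_{il} - ∂_l g_{ij})` of the
Levi-Civita connection of `g` in the chart `c`. -/
def christoffel (k i j : Fin 3) (x : E3) : ℝ :=
  (1 / 2 : ℝ) * ∑ l, (metricMatrix g c x)⁻¹ k l *
    (partialDeriv i (fun y ↦ metricMatrix g c y j l) x
      + partialDeriv j (fun y ↦ metricMatrix g c y i l) x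
      - partialDeriv l (fun y ↦ metricMatrix g c y i j) x)

/-- The Ricci tensor `R_{ij} = ∂_k Γ^k_{ij} - ∂_i Γ^k_{kj} + Γ^k_{km} Γ^m_{ij} - Γ^k_{im} Γ^m_{kj}`
of `g` in the chart `c`. -/
def ricci (i j : Fin 3) (x : E3) : ℝ :=
  ∑ k, (partialDeriv k (christoffel g c k i j) x - partialDeriv i (christoffel g c k k j) x
    + ∑ m, (christoffel g c k k m x * christoffel g c m i j x
      - christoffel g c k i m x * christoffel g c m k j x))

/-- The scalar curvature `R = g^{ij} R_{ij}` of `g`, as a function of the coordinates of `c`. -/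
def scalarCurvature (x : E3) : ℝ :=
  ∑ i, ∑ j, (metricMatrix g c x)⁻¹ i j * ricci g c i j x

/-- The components of the covariant derivative `D_{a 0} A_{a 1 … a n}` of a covariant tensor of
rank `n`, given by its components in the chart `c`. The new index comes first. -/
def covDeriv {n : ℕ} (A : (Fin n → Fin 3) → E3 → ℝ) (a : Fin (n + 1) → Fin 3) (x : E3) : ℝ :=
  partialDeriv (a 0) (A (Fin.tail a)) x
    - ∑ m : Fin n, ∑ l : Fin 3, christoffel g c l (a 0) (a m.succ) x *
        A (Function.update (Fin.tail a) m l) x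

/-- The components of the `n`-th covariant derivative `D_{a 0} ⋯ D_{a (n-1)} φ` of a function. -/
def iterCovDeriv (φ : T → ℝ) : (n : ℕ) → (Fin n → Fin 3) → E3 → ℝ
  | 0 => fun _ x ↦ φ (c.symm x)
  | n + 1 => covDeriv g c (iterCovDeriv φ n)

/-- All covariant derivatives of `φ` of order at least three exist and vanish identically. -/
def HigherDerivativesVanish [IsManifold (𝓡 3) ∞ T] (φ : T → ℝ) : Prop :=
  ∀ c ∈ IsManifold.maximalAtlas (𝓡 3) ∞ T, ∀ x ∈ c.target,
    (∀ a : Fin 2 → Fin 3, DifferentiableAt ℝ (iterCovDeriv g c φ 2 a) x) ∧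
    ∀ n : ℕ, 3 ≤ n → ∀ a : Fin n → Fin 3, iterCovDeriv g c φ n a x = 0

/-- The scalar curvature of the metric `g` is the constant `C`. -/
def HasConstantScalarCurvature [IsManifold (𝓡 3) ∞ T] (C : ℝ) : Prop :=
  ∀ c ∈ IsManifold.maximalAtlas (𝓡 3) ∞ T, ∀ x ∈ c.target, scalarCurvature g c x = C

end Charts

namespace Hypersurface

variable {M : Type*} [TopologicalSpace M] [ChartedSpace E4 M] [IsManifold (𝓡 4) ∞ M]
  {S : Decomposition M}
  {T : Type*} [TopologicalSpace T] [ChartedSpace E3 T] [IsManifold (𝓡 3) ∞ T]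
  (H : Hypersurface S T)

/-- The sheet metric `N` of the spacetime, restricted to the hypersurface. -/
def N (p : T) (v w : TangentSpace (𝓡 3) p) : ℝ :=
  S.N (H.ι p) (mfderiv (𝓡 3) (𝓡 4) H.ι p v) (mfderiv (𝓡 3) (𝓡 4) H.ι p w)

/-- The Ricci tensor of the induced metric is `α e_μ e_ν + β N_{μν}`. -/
def HasRicciForm (α β : T → ℝ) : Prop :=
  ∀ c ∈ IsManifold.maximalAtlas (𝓡 3) ∞ T, ∀ x ∈ c.target, ∀ i j : Fin 3,
    ricci H.h.inner c i j x =
      α (c.symm x) * (H.h.inner (c.symm x) (H.e (c.symm x)) (coordVec c i x) *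
        H.h.inner (c.symm x) (H.e (c.symm x)) (coordVec c j x))
      + β (c.symm x) * H.N (c.symm x) (coordVec c i x) (coordVec c j x)

/-- The hat derivative `ψ ↦ e^μ D_μ ψ` of a function. -/
def hat (ψ : T → ℝ) (p : T) : ℝ := mfderiv (𝓡 3) 𝓘(ℝ, ℝ) ψ p (H.e p)

/-- The sheet derivative `δ_μ ψ = N_μ^ν D_ν ψ` of a function, contracted with a vector `v`. -/
def delta (ψ : T → ℝ) (p : T) (v : TangentSpace (𝓡 3) p) : ℝ :=
  mfderiv (𝓡 3) 𝓘(ℝ, ℝ) ψ p (v - H.h.inner p (H.e p) v • H.e p)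

/-- The conformally transformed metric `e^{2φ} h`. -/
def conformalMetric (φ : T → ℝ) (p : T) :
    TangentSpace (𝓡 3) p →L[ℝ] TangentSpace (𝓡 3) p →L[ℝ] ℝ :=
  Real.exp (2 * φ p) • H.h.inner p

end Hypersurface

end SplitSpacetime

end

/-! Write `f` for the hat derivative of `φ`, `n` for its gradient (so `n = f e`), `q = |n|² = f²`,
`B` for its Hessian, `R` for the scalar curvature of `h` and `C` for that of `e^{2φ} h`. Everything
reduces to showing that `e(f) ≤ 0`: the positivity hypothesis then gives `f² > -2 e(f) ≥ |e(f)|`.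
Since `B(n,n) = f² e(f)`, it suffices to prove `B(n,n) ≤ 0` where `f ≠ 0`, and then to treat zeros
of `f` by continuity.

The tensor `B` is parallel, so commuting covariant derivatives gives `Riem · n = 0`, hence `Ric(n) =
0`. Where `f ≠ 0` the prescribed form of the Ricci tensor therefore becomes `Ric = (R/2)(h - n ⊗ n /
q)`. The contracted Bianchi identity for this tensor says that `(R/q) B n` is a multiple of `n`
(`bianchi_grad`), and paired with `n` it gives `n(R) = -R (Δφ - λ)` with `λ = B(n,n)/q`.

The conformal law in dimension three reads `R = 4 Δφ + 2 q + C e^{2φ}`. As `Δφ` is constant, it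
gives `n(R) = 4 B(n,n) + 2 C e^{2φ} q`.

Suppose `B(n,n) > 0` at a point where `R ≠ 0`. Then `B n = λ n` nearby, and differentiating this
relation yields `B² = λ B`; so `B/λ` is a nonzero projection and `Δφ ≥ λ > 0` (`le_lapl`). Then `R >
0`, the first formula gives `n(R) ≤ 0` and the second `n(R) > 0`. If instead `R` vanishes near the
point, the second formula alone gives `B(n,n) ≤ 0`.

All of this is computed with components in a chart. -/

open scoped Topology

noncomputable section

namespace SplitSpacetime

/-! ### Calculus of partial derivatives -/

/-- `F` is differentiable at `x` with partial derivative `∂_a F = d` there. -/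
def HasPartial (a : Fin 3) (F : E3 → ℝ) (d : ℝ) (x : E3) : Prop :=
  DifferentiableAt ℝ F x ∧ partialDeriv a F x = d

namespace HasPartial

variable {a : Fin 3} {F F₁ F₂ : E3 → ℝ} {d d₁ d₂ : ℝ} {x : E3}

theorem of_differentiableAt (h : DifferentiableAt ℝ F x) :
    HasPartial a F (partialDeriv a F x) x := ⟨h, rfl⟩

theorem of_eq (h : HasPartial a F d₁ x) (hd : d₁ = d₂) : HasPartial a F d₂ x := hd ▸ h

theorem unique (h₁ : HasPartial a F d₁ x) (h₂ : HasPartial a F d₂ x) : d₁ = d₂ :=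
  h₁.2.symm.trans h₂.2

theorem congr (h : HasPartial a F₁ d x) (hF : F₂ =ᶠ[𝓝 x] F₁) : HasPartial a F₂ d x :=
  ⟨h.1.congr_of_eventuallyEq hF, by
    rw [← h.2, partialDeriv, partialDeriv, hF.fderiv_eq]⟩

theorem const (k : ℝ) : HasPartial a (fun _ ↦ k) 0 x :=
  ⟨differentiableAt_const k, by simp [partialDeriv]⟩

theorem add (h₁ : HasPartial a F₁ d₁ x) (h₂ : HasPartial a F₂ d₂ x) :
    HasPartial a (fun y ↦ F₁ y + F₂ y) (d₁ + d₂) x :=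
  ⟨h₁.1.add h₂.1, by
    rw [← h₁.2, ← h₂.2, partialDeriv, fderiv_fun_add h₁.1 h₂.1]; rfl⟩

theorem neg (h₁ : HasPartial a F₁ d₁ x) : HasPartial a (fun y ↦ -F₁ y) (-d₁) x :=
  ⟨h₁.1.neg, by rw [← h₁.2, partialDeriv, fderiv_fun_neg]; rfl⟩

theorem sub (h₁ : HasPartial a F₁ d₁ x) (h₂ : HasPartial a F₂ d₂ x) :
    HasPartial a (fun y ↦ F₁ y - F₂ y) (d₁ - d₂) x :=
  ⟨h₁.1.sub h₂.1, by
    rw [← h₁.2, ← h₂.2, partialDeriv, fderiv_fun_sub h₁.1 h₂.1]; rfl⟩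

theorem mul (h₁ : HasPartial a F₁ d₁ x) (h₂ : HasPartial a F₂ d₂ x) :
    HasPartial a (fun y ↦ F₁ y * F₂ y) (d₁ * F₂ x + F₁ x * d₂) x :=
  ⟨h₁.1.mul h₂.1, by
    rw [← h₁.2, ← h₂.2, partialDeriv, fderiv_fun_mul h₁.1 h₂.1]
    simp [partialDeriv]; ring⟩

theorem const_mul (k : ℝ) (h₁ : HasPartial a F₁ d₁ x) :
    HasPartial a (fun y ↦ k * F₁ y) (k * d₁) x :=
  ((const k).mul h₁).of_eq (by ring)

theorem exp (h₁ : HasPartial a F₁ d₁ x) :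
    HasPartial a (fun y ↦ Real.exp (F₁ y)) (Real.exp (F₁ x) * d₁) x :=
  ⟨h₁.1.exp, by rw [← h₁.2, partialDeriv, fderiv_exp h₁.1]; rfl⟩

theorem div (h₁ : HasPartial a F₁ d₁ x) (h₂ : HasPartial a F₂ d₂ x) (h : F₂ x ≠ 0) :
    HasPartial a (fun y ↦ F₁ y / F₂ y) ((d₁ * F₂ x - F₁ x * d₂) / F₂ x ^ 2) x := by
  have h₃ : HasPartial a (fun y ↦ F₁ y / F₂ y) (partialDeriv a (fun y ↦ F₁ y / F₂ y) x) x :=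
    of_differentiableAt (by simpa only [div_eq_mul_inv] using h₁.1.fun_mul (h₂.1.fun_inv h))
  -- The derivative of the quotient is solved for from the product rule for `F₁ = (F₁ / F₂) * F₂`,
  -- which holds near `x`.
  have h₄ : HasPartial a F₁ _ x := (h₃.mul h₂).congr (by
    filter_upwards [h₂.1.continuousAt.eventually_ne h] with y hy
    field_simp)
  refine h₃.of_eq ?_
  have := h₁.unique h₄
  field_simp at this ⊢
  linear_combination -this

theorem sum {ι : Type*} {s : Finset ι} {f : ι → E3 → ℝ} {f' : ι → ℝ}
    (h : ∀ i, HasPartial a (f i) (f' i) x) :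
    HasPartial a (fun y ↦ ∑ i ∈ s, f i y) (∑ i ∈ s, f' i) x :=
  ⟨DifferentiableAt.fun_sum fun i _ ↦ (h i).1, by
    rw [partialDeriv, fderiv_fun_sum fun i _ ↦ (h i).1, sum_apply]
    exact Finset.sum_congr rfl fun i _ ↦ (h i).2⟩

end HasPartial

theorem sum_smul_single (w : E3) : w = ∑ i, w i • EuclideanSpace.single i (1 : ℝ) := by
  ext j
  simp [Pi.single_apply]

theorem clm_apply_eq_sum (L : E3 →L[ℝ] ℝ) (w : E3) :
    L w = ∑ i, w i * L (EuclideanSpace.single i (1 : ℝ)) := by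
  conv_lhs => rw [sum_smul_single w]
  simp

/-- Second partial derivatives commute, for a function that is differentiable near a point and has
differentiable partial derivatives there. -/
theorem partialDeriv_comm {F : E3 → ℝ} {x : E3} (hF : ∀ᶠ y in 𝓝 x, DifferentiableAt ℝ F y)
    (hF' : ∀ a, DifferentiableAt ℝ (partialDeriv a F) x) (a b : Fin 3) :
    partialDeriv a (partialDeriv b F) x = partialDeriv b (partialDeriv a F) x := by
  -- The full derivative is assembled from its three components, so it is differentiable at `x` as
  -- soon as they are; no third-order smoothness enters.
  have key : fderiv ℝ F = fun y ↦ ∑ i : Fin 3, partialDeriv i F y •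
      (EuclideanSpace.proj i : E3 →L[ℝ] ℝ) := by
    funext y
    ext w
    rw [clm_apply_eq_sum]
    simp [partialDeriv, mul_comm]
  have hd : DifferentiableAt ℝ (fderiv ℝ F) x := by
    rw [key]
    exact DifferentiableAt.fun_sum fun i _ ↦ (hF' i).smul_const _
  have h := second_derivative_symmetric_of_eventually (f := F) (f' := fderiv ℝ F)
    (hF.mono fun y hy ↦ hy.hasFDerivAt) hd.hasFDerivAt
  have e (i j : Fin 3) : partialDeriv i (partialDeriv j F) x =
      fderiv ℝ (fderiv ℝ F) x (EuclideanSpace.single i (1 : ℝ))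
        (EuclideanSpace.single j (1 : ℝ)) := by
    change fderiv ℝ (fun y ↦ fderiv ℝ F y (EuclideanSpace.single j (1 : ℝ))) x _ = _
    rw [fderiv_clm_apply hd (differentiableAt_const _)]
    simp
  rw [e, e, h]

theorem contDiffOn_partialDeriv {F : E3 → ℝ} {U : Set E3} (hU : IsOpen U)
    {m n : ℕ∞ω} (hF : ContDiffOn ℝ n F U) (hmn : m + 1 ≤ n) (a : Fin 3) :
    ContDiffOn ℝ m (partialDeriv a F) U :=
  (hF.fderiv_of_isOpen hU hmn).clm_apply contDiffOn_const

/-! ### Curvature in coordinates and the Bianchi identities -/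

/-- A symmetric, smooth, nondegenerate matrix-valued function on an open set of coordinates. -/
structure IsLocalMetric (U : Set E3) (G : E3 → Matrix (Fin 3) (Fin 3) ℝ) : Prop where
  isOpen : IsOpen U
  symm : ∀ x i j, G x i j = G x j i
  smooth : ∀ i j, ContDiffOn ℝ ∞ (fun x ↦ G x i j) U
  det_ne_zero : ∀ x ∈ U, (G x).det ≠ 0

/-- The Christoffel symbols of a metric given by its matrix. -/
def gammaOf (G : E3 → Matrix (Fin 3) (Fin 3) ℝ) (k i j : Fin 3) (x : E3) : ℝ :=
  (1 / 2 : ℝ) * ∑ l, (G x)⁻¹ k l *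
    (partialDeriv i (fun y ↦ G y j l) x + partialDeriv j (fun y ↦ G y i l) x
      - partialDeriv l (fun y ↦ G y i j) x)

/-- The curvature `∂_a Γ_b - ∂_b Γ_a + Γ_a Γ_b - Γ_b Γ_a` of a connection. -/
def curvOf (Γ : Fin 3 → Fin 3 → Fin 3 → E3 → ℝ) (k c a b : Fin 3) (x : E3) : ℝ :=
  partialDeriv a (Γ k b c) x - partialDeriv b (Γ k a c) x
    + ∑ m, (Γ k a m x * Γ m b c x - Γ k b m x * Γ m a c x)

/-- The Ricci tensor of a connection. -/
def ricOf (Γ : Fin 3 → Fin 3 → Fin 3 → E3 → ℝ) (i j : Fin 3) (x : E3) : ℝ :=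
  ∑ k, curvOf Γ k j k i x

/-- The curvature with the second index raised. -/
def curvUp (G : E3 → Matrix (Fin 3) (Fin 3) ℝ) (a b i j : Fin 3) (x : E3) : ℝ :=
  ∑ m, curvOf (gammaOf G) i m a b x * (G x)⁻¹ m j

/-- The scalar curvature of a metric given by its matrix. -/
def scalOf (G : E3 → Matrix (Fin 3) (Fin 3) ℝ) (x : E3) : ℝ :=
  ∑ i, ∑ j, (G x)⁻¹ i j * ricOf (gammaOf G) i j x

theorem christoffel_eq_gammaOf {T : Type*} [TopologicalSpace T] [ChartedSpace E3 T]
    (g : ∀ p : T, TangentSpace (𝓡 3) p →L[ℝ] TangentSpace (𝓡 3) p →L[ℝ] ℝ)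
    (c : OpenPartialHomeomorph T E3) : christoffel g c = gammaOf (metricMatrix g c) := rfl

namespace IsLocalMetric

variable {U : Set E3} {G : E3 → Matrix (Fin 3) (Fin 3) ℝ}

theorem inv_symm (hG : IsLocalMetric U G) (x : E3) (i j : Fin 3) : (G x)⁻¹ i j = (G x)⁻¹ j i := by
  have h : (G x).transpose = G x := Matrix.ext fun i j ↦ hG.symm x j i
  conv_lhs => rw [← h, ← Matrix.transpose_nonsing_inv, Matrix.transpose_apply]

theorem sum_inv_mul (hG : IsLocalMetric U G) {x : E3} (hx : x ∈ U) (i j : Fin 3) :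
    ∑ m, (G x)⁻¹ i m * G x m j = if i = j then 1 else 0 := by
  rw [← Matrix.mul_apply, Matrix.nonsing_inv_mul _ (hG.det_ne_zero x hx).isUnit, Matrix.one_apply]

theorem sum_mul_inv (hG : IsLocalMetric U G) {x : E3} (hx : x ∈ U) (i j : Fin 3) :
    ∑ m, G x i m * (G x)⁻¹ m j = if i = j then 1 else 0 := by
  rw [← Matrix.mul_apply, Matrix.mul_nonsing_inv _ (hG.det_ne_zero x hx).isUnit, Matrix.one_apply]

theorem inv_smooth (hG : IsLocalMetric U G) (i j : Fin 3) :
    ContDiffOn ℝ ∞ (fun x ↦ (G x)⁻¹ i j) U := by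
  have hdet : ContDiffOn ℝ ∞ (fun x ↦ (G x).det) U := by
    simp only [Matrix.det_apply']
    exact ContDiffOn.sum fun σ _ ↦ contDiffOn_const.mul
      (contDiffOn_prod fun k _ ↦ hG.smooth _ _)
  have hadj : ContDiffOn ℝ ∞ (fun x ↦ (G x).adjugate i j) U := by
    simp only [Matrix.adjugate_apply, Matrix.det_apply']
    refine ContDiffOn.sum fun σ _ ↦ contDiffOn_const.mul (contDiffOn_prod fun k _ ↦ ?_)
    simp only [Matrix.updateRow_apply]
    split_ifs
    · exact contDiffOn_const
    · exact hG.smooth _ _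
  have : (fun x ↦ (G x)⁻¹ i j) = fun x ↦ ((G x).det)⁻¹ * (G x).adjugate i j := by
    funext x
    rw [Matrix.inv_def, Ring.inverse_eq_inv', Matrix.smul_apply, smul_eq_mul]
  rw [this]
  exact (hdet.inv hG.det_ne_zero).mul hadj

theorem gamma_smooth (hG : IsLocalMetric U G) (k i j : Fin 3) :
    ContDiffOn ℝ ∞ (gammaOf G k i j) U := by
  have hp (a i j : Fin 3) : ContDiffOn ℝ ∞ (partialDeriv a fun y ↦ G y i j) U :=
    contDiffOn_partialDeriv hG.isOpen (hG.smooth i j) (by simp) a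
  exact contDiffOn_const.mul (ContDiffOn.sum fun l _ ↦
    (hG.inv_smooth k l).mul (((hp i j l).add (hp j i l)).sub (hp l i j)))

theorem curv_smooth (hG : IsLocalMetric U G) (k c a b : Fin 3) :
    ContDiffOn ℝ ∞ (curvOf (gammaOf G) k c a b) U := by
  have hp (a k i j : Fin 3) : ContDiffOn ℝ ∞ (partialDeriv a (gammaOf G k i j)) U :=
    contDiffOn_partialDeriv hG.isOpen (hG.gamma_smooth k i j) (by simp) a
  have hΓ := hG.gamma_smooth
  exact ((hp a k b c).sub (hp b k a c)).add (ContDiffOn.sum fun m _ ↦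
    ((hΓ k a m).mul (hΓ m b c)).sub ((hΓ k b m).mul (hΓ m a c)))

theorem differentiableAt (hG : IsLocalMetric U G) {F : E3 → ℝ} (hF : ContDiffOn ℝ ∞ F U) {x : E3}
    (hx : x ∈ U) : DifferentiableAt ℝ F x :=
  (hF.contDiffAt (hG.isOpen.mem_nhds hx)).differentiableAt (by simp)

theorem hasPartial (hG : IsLocalMetric U G) {F : E3 → ℝ} (hF : ContDiffOn ℝ ∞ F U) {x : E3}
    (hx : x ∈ U) (a : Fin 3) : HasPartial a F (partialDeriv a F x) x :=
  .of_differentiableAt (hG.differentiableAt hF hx)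

theorem hasPartial₂ (hG : IsLocalMetric U G) {F : E3 → ℝ} (hF : ContDiffOn ℝ ∞ F U) {x : E3}
    (hx : x ∈ U) (a b : Fin 3) :
    HasPartial a (partialDeriv b F) (partialDeriv a (partialDeriv b F) x) x :=
  hG.hasPartial (contDiffOn_partialDeriv hG.isOpen hF (by simp) b) hx a

theorem partialDeriv_comm (hG : IsLocalMetric U G) {F : E3 → ℝ} (hF : ContDiffOn ℝ ∞ F U) {x : E3}
    (hx : x ∈ U) (a b : Fin 3) :
    partialDeriv a (partialDeriv b F) x = partialDeriv b (partialDeriv a F) x :=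
  SplitSpacetime.partialDeriv_comm
    (Filter.eventually_of_mem (hG.isOpen.mem_nhds hx) fun _ hy ↦ hG.differentiableAt hF hy)
    (fun c ↦ (hG.hasPartial₂ hF hx c c).1) a b

theorem gamma_symm (hG : IsLocalMetric U G) (k i j : Fin 3) :
    gammaOf G k i j = gammaOf G k j i := by
  funext x
  have : (fun y ↦ G y i j) = fun y ↦ G y j i := funext fun y ↦ hG.symm y i j
  simp only [gammaOf, this]
  congr 1
  exact Finset.sum_congr rfl fun l _ ↦ by ring

theorem lower_gamma (hG : IsLocalMetric U G) {x : E3} (hx : x ∈ U) (c i j : Fin 3) :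
    ∑ k, G x c k * gammaOf G k i j x = (1 / 2 : ℝ) * (partialDeriv i (fun y ↦ G y j c) x
      + partialDeriv j (fun y ↦ G y i c) x - partialDeriv c (fun y ↦ G y i j) x) := by
  simp only [gammaOf, Finset.mul_sum]
  rw [Finset.sum_comm]
  have h (l : Fin 3) : ∑ k, G x c k * ((1 / 2 : ℝ) * ((G x)⁻¹ k l *
      (partialDeriv i (fun y ↦ G y j l) x + partialDeriv j (fun y ↦ G y i l) x
        - partialDeriv l (fun y ↦ G y i j) x))) = (if c = l then 1 else 0) * ((1 / 2 : ℝ) *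
      (partialDeriv i (fun y ↦ G y j l) x + partialDeriv j (fun y ↦ G y i l) x
        - partialDeriv l (fun y ↦ G y i j) x)) := by
    rw [← hG.sum_mul_inv hx, Finset.sum_mul]
    exact Finset.sum_congr rfl fun k _ ↦ by ring
  rw [Finset.sum_congr rfl fun l _ ↦ h l]
  simp

/-- Metric compatibility: in the sum of the two lowered Christoffel symbols, four of the six
derivative terms cancel. -/
theorem hasPartial_metric (hG : IsLocalMetric U G) {x : E3} (hx : x ∈ U) (a b c : Fin 3) :
    HasPartial a (fun y ↦ G y b c)
      (∑ m, (gammaOf G m a b x * G x m c + gammaOf G m a c x * G x b m)) x := by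
  refine (hG.hasPartial (hG.smooth b c) hx a).of_eq ?_
  have h₁ := hG.lower_gamma hx c a b
  have h₂ := hG.lower_gamma hx b a c
  have e (i j : Fin 3) : (fun y ↦ G y i j) = fun y ↦ G y j i := funext fun y ↦ hG.symm y i j
  rw [Finset.sum_add_distrib]
  have h₃ : ∑ m, gammaOf G m a b x * G x m c = ∑ m, G x c m * gammaOf G m a b x :=
    Finset.sum_congr rfl fun m _ ↦ by rw [hG.symm x m c, mul_comm]
  have h₄ : ∑ m, gammaOf G m a c x * G x b m = ∑ m, G x b m * gammaOf G m a c x :=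
    Finset.sum_congr rfl fun m _ ↦ by rw [mul_comm]
  rw [h₃, h₄, h₁, h₂, e c b]
  ring

/-- Differentiate `G⁻¹ G = 1`, insert metric compatibility, and contract with the inverse. -/
theorem hasPartial_inv (hG : IsLocalMetric U G) {x : E3} (hx : x ∈ U) (a i j : Fin 3) :
    HasPartial a (fun y ↦ (G y)⁻¹ i j)
      (-∑ m, (gammaOf G i a m x * (G x)⁻¹ m j + gammaOf G j a m x * (G x)⁻¹ i m)) x := by
  have hd (k : Fin 3) : ∑ m, (partialDeriv a (fun y ↦ (G y)⁻¹ i m) x * G x m k + (G x)⁻¹ i m *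
      ∑ l, (gammaOf G l a m x * G x l k + gammaOf G l a k x * G x m l)) = 0 := by
    refine HasPartial.unique (.sum fun m ↦ (hG.hasPartial (hG.inv_smooth i m) hx a).mul
      (hG.hasPartial_metric hx a m k)) ((HasPartial.const (if i = k then 1 else 0)).congr ?_)
    filter_upwards [hG.isOpen.mem_nhds hx] with y hy using hG.sum_inv_mul hy i k
  refine (hG.hasPartial (hG.inv_smooth i j) hx a).of_eq ?_
  have h₁ : ∑ k, (∑ m, (partialDeriv a (fun y ↦ (G y)⁻¹ i m) x * G x m k + (G x)⁻¹ i m *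
      ∑ l, (gammaOf G l a m x * G x l k + gammaOf G l a k x * G x m l))) * (G x)⁻¹ k j = 0 :=
    Finset.sum_eq_zero fun k _ ↦ by rw [hd, zero_mul]
  have e₁ := fun m ↦ hG.sum_mul_inv hx m j
  have e₂ := fun m ↦ hG.sum_inv_mul hx i m
  have h₂ : ∑ m, partialDeriv a (fun y ↦ (G y)⁻¹ i m) x * (∑ k, G x m k * (G x)⁻¹ k j)
      + ∑ m, ∑ l, (G x)⁻¹ i m * gammaOf G l a m x * (∑ k, G x l k * (G x)⁻¹ k j)
      + ∑ l, ∑ k, gammaOf G l a k x * (G x)⁻¹ k j * (∑ m, (G x)⁻¹ i m * G x m l) = 0 := by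
    rw [← h₁]
    simp only [Fin.sum_univ_three]
    ring
  simp only [e₁, e₂, mul_ite, mul_one, mul_zero, Finset.sum_ite_eq',
    Finset.mem_univ, if_true] at h₂
  have h₃ : ∑ l : Fin 3, ∑ k : Fin 3, (if i = l then gammaOf G l a k x * (G x)⁻¹ k j else 0) =
      ∑ k, gammaOf G i a k x * (G x)⁻¹ k j := by
    rw [Finset.sum_comm]
    simp
  rw [h₃] at h₂
  rw [Finset.sum_add_distrib]
  have h₄ : ∑ m, gammaOf G j a m x * (G x)⁻¹ i m = ∑ m, (G x)⁻¹ i m * gammaOf G j a m x :=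
    Finset.sum_congr rfl fun m _ ↦ mul_comm _ _
  rw [h₄]
  linarith

/-- Because the inverse metric is covariantly constant, the commutator of `∂_a` and `∂_b` on
`g^{ij}` equals, up to sign, the symmetric part of the curvature in `i, j`; it vanishes. -/
theorem curvUp_antisymm (hG : IsLocalMetric U G) {x : E3} (hx : x ∈ U) (a b i j : Fin 3) :
    curvUp G a b i j x = -curvUp G a b j i x := by
  have h (c d : Fin 3) : HasPartial c (partialDeriv d fun y ↦ (G y)⁻¹ i j) _ x :=
    (HasPartial.neg (.sum fun m ↦
      ((hG.hasPartial (hG.gamma_smooth i d m) hx c).mul (hG.hasPartial_inv hx c m j)).add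
      ((hG.hasPartial (hG.gamma_smooth j d m) hx c).mul (hG.hasPartial_inv hx c i m)))).congr (by
      filter_upwards [hG.isOpen.mem_nhds hx] with y hy
      exact (hG.hasPartial_inv hy d i j).2)
  have h₁ := hG.partialDeriv_comm (hG.inv_smooth i j) hx a b
  rw [(h a b).2, (h b a).2] at h₁
  simp only [curvUp, curvOf, Fin.sum_univ_three] at h₁ ⊢
  have e := hG.inv_symm x
  rw [e 1 0, e 2 0, e 2 1] at *
  rw [e 0 i, e 1 i, e 2 i]
  linear_combination -h₁

theorem curv_antisymm (G : E3 → Matrix (Fin 3) (Fin 3) ℝ) (k c a b : Fin 3) (x : E3) :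
    curvOf (gammaOf G) k c a b x = -curvOf (gammaOf G) k c b a x := by
  simp only [curvOf, Fin.sum_univ_three]
  ring

/-- The second Bianchi identity. -/
theorem bianchi (hG : IsLocalMetric U G) {x : E3} (hx : x ∈ U) (k c e a b : Fin 3) :
    partialDeriv e (curvOf (gammaOf G) k c a b) x + partialDeriv a (curvOf (gammaOf G) k c b e) x
      + partialDeriv b (curvOf (gammaOf G) k c e a) x =
    -∑ n, (gammaOf G k e n x * curvOf (gammaOf G) n c a b x
        - curvOf (gammaOf G) k n a b x * gammaOf G n e c x
      + (gammaOf G k a n x * curvOf (gammaOf G) n c b e x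
        - curvOf (gammaOf G) k n b e x * gammaOf G n a c x)
      + (gammaOf G k b n x * curvOf (gammaOf G) n c e a x
        - curvOf (gammaOf G) k n e a x * gammaOf G n b c x)) := by
  have hΓ := fun k i j d ↦ hG.hasPartial (hG.gamma_smooth k i j) hx d
  have h (e a b : Fin 3) : HasPartial e (curvOf (gammaOf G) k c a b) _ x :=
    ((hG.hasPartial₂ (hG.gamma_smooth k b c) hx e a).sub
      (hG.hasPartial₂ (hG.gamma_smooth k a c) hx e b)).add (.sum fun m ↦
        ((hΓ k a m e).mul (hΓ m b c e)).sub ((hΓ k b m e).mul (hΓ m a c e)))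
  rw [(h e a b).2, (h a b e).2, (h b e a).2]
  -- In the cyclic sum the second derivatives of the Christoffel symbols cancel in pairs; the rest
  -- is polynomial.
  have s₁ := hG.partialDeriv_comm (hG.gamma_smooth k b c) hx e a
  have s₂ := hG.partialDeriv_comm (hG.gamma_smooth k e c) hx a b
  have s₃ := hG.partialDeriv_comm (hG.gamma_smooth k a c) hx b e
  simp only [curvOf, Fin.sum_univ_three]
  linear_combination s₁ + s₂ + s₃

end IsLocalMetric

/-- The Ricci tensor with the second index raised. -/
def ricUp (G : E3 → Matrix (Fin 3) (Fin 3) ℝ) (e a : Fin 3) (x : E3) : ℝ :=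
  ∑ b, curvUp G b e b a x

theorem ricUp_eq (G : E3 → Matrix (Fin 3) (Fin 3) ℝ) (e a : Fin 3) (x : E3) :
    ricUp G e a x = ∑ j, ricOf (gammaOf G) e j x * (G x)⁻¹ j a := by
  simp only [ricUp, curvUp, ricOf, Finset.sum_mul]
  exact Finset.sum_comm

/-- The contraction of the connection terms of the second Bianchi identity. -/
theorem contract_connection_terms (S : Fin 3 → Fin 3 → Fin 3 → Fin 3 → ℝ)
    (h₁ : ∀ a b i j, S a b i j = -S b a i j) (h₂ : ∀ a b i j, S a b i j = -S a b j i)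
    (Γ : Fin 3 → Fin 3 → Fin 3 → ℝ) (hΓ : ∀ k i j, Γ k i j = Γ k j i) (e : Fin 3) :
    ∑ a, ∑ b, ∑ n, (Γ a e n * S a b n b + Γ b e n * S a b a n + (Γ a a n * S b e n b
      + Γ b a n * S b e a n) + (Γ a b n * S e a n b + Γ b b n * S e a a n)) =
    2 * ∑ a, ∑ m, (Γ m a e * ∑ b, S b m b a - Γ a a m * ∑ b, S b e b m) := by
  -- The symmetries serve as rewriting rules to one ordering of each index pair, after which `ring`
  -- can compare both sides.
  have z₁ (a i j) : S a a i j = 0 := by linarith [h₁ a a i j]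
  have z₂ (a b i) : S a b i i = 0 := by linarith [h₂ a b i i]
  have g₁ := fun k ↦ hΓ k 1 0
  have g₂ := fun k ↦ hΓ k 2 0
  have g₃ := fun k ↦ hΓ k 2 1
  have a₁ := h₁ 1 0
  have a₂ := h₁ 2 0
  have a₃ := h₁ 2 1
  have b₁ := fun a b ↦ h₂ a b 1 0
  have b₂ := fun a b ↦ h₂ a b 2 0
  have b₃ := fun a b ↦ h₂ a b 2 1
  obtain rfl | rfl | rfl : e = 0 ∨ e = 1 ∨ e = 2 := by fin_cases e <;> simp
  all_goals
    simp only [Fin.sum_univ_three, z₁, z₂, g₁, g₂, g₃, a₁, a₂, a₃, b₁, b₂, b₃]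
    ring

/-- Here `D c a b i j` stands for `∂_c` of the curvature `R_{ab}^{ij}`. By the two antisymmetries,
the last two cyclic terms both reduce to minus the same divergence of the Ricci tensor. -/
theorem contract_derivative_terms (D : Fin 3 → Fin 3 → Fin 3 → Fin 3 → Fin 3 → ℝ)
    (h₁ : ∀ c a b i j, D c a b i j = -D c b a i j) (h₂ : ∀ c a b i j, D c a b i j = -D c a b j i)
    (e : Fin 3) :
    ∑ a, ∑ b, (D e a b a b + D a b e a b + D b e a a b) =
      ∑ a, ∑ b, D e a b a b - 2 * ∑ a, ∑ b, D a b e b a := by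
  have k₁ : ∑ a, ∑ b, D b e a a b = ∑ a, ∑ b, D a b e a b := by
    rw [Finset.sum_comm]
    exact Finset.sum_congr rfl fun b _ ↦ Finset.sum_congr rfl fun a _ ↦ by
      rw [h₁, h₂, neg_neg]
  have k₂ : ∑ a, ∑ b, D a b e a b = -∑ a, ∑ b, D a b e b a := by
    simp only [← Finset.sum_neg_distrib]
    exact Finset.sum_congr rfl fun b _ ↦ Finset.sum_congr rfl fun a _ ↦ h₂ _ _ _ _ _
  simp only [Finset.sum_add_distrib, k₁, k₂]
  ring

namespace IsLocalMetric

variable {U : Set E3} {G : E3 → Matrix (Fin 3) (Fin 3) ℝ}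

theorem ric_smooth (hG : IsLocalMetric U G) (i j : Fin 3) :
    ContDiffOn ℝ ∞ (ricOf (gammaOf G) i j) U :=
  ContDiffOn.sum fun k _ ↦ hG.curv_smooth k j k i

theorem scal_smooth (hG : IsLocalMetric U G) : ContDiffOn ℝ ∞ (scalOf G) U :=
  ContDiffOn.sum fun i _ ↦ ContDiffOn.sum fun j _ ↦ (hG.inv_smooth i j).mul (hG.ric_smooth i j)

theorem curvUp_smooth (hG : IsLocalMetric U G) (a b i j : Fin 3) :
    ContDiffOn ℝ ∞ (curvUp G a b i j) U :=
  ContDiffOn.sum fun m _ ↦ (hG.curv_smooth i m a b).mul (hG.inv_smooth m j)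

theorem scalOf_eq (hG : IsLocalMetric U G) : scalOf G = fun x ↦ ∑ a, ∑ b, curvUp G a b a b x := by
  funext x
  rw [Finset.sum_comm]
  simp only [scalOf, curvUp, ricOf, Finset.mul_sum]
  refine Finset.sum_congr rfl fun i _ ↦ ?_
  rw [Finset.sum_comm]
  exact Finset.sum_congr rfl fun k _ ↦ Finset.sum_congr rfl fun j _ ↦ by
    rw [hG.inv_symm x i j, mul_comm]

/-- Raising an index preserves the second Bianchi identity since the inverse metric is parallel. In
this form the traces can be taken without the metric. -/
theorem bianchi_up (hG : IsLocalMetric U G) {x : E3} (hx : x ∈ U) (e a b i j : Fin 3) :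
    partialDeriv e (curvUp G a b i j) x + partialDeriv a (curvUp G b e i j) x
      + partialDeriv b (curvUp G e a i j) x =
    -∑ n, (gammaOf G i e n x * curvUp G a b n j x + gammaOf G j e n x * curvUp G a b i n x
      + (gammaOf G i a n x * curvUp G b e n j x + gammaOf G j a n x * curvUp G b e i n x)
      + (gammaOf G i b n x * curvUp G e a n j x + gammaOf G j b n x * curvUp G e a i n x)) := by
  have h (e a b : Fin 3) : HasPartial e (curvUp G a b i j) _ x :=
    .sum fun m ↦ (hG.hasPartial (hG.curv_smooth i m a b) hx e).mul (hG.hasPartial_inv hx e m j)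
  rw [(h e a b).2, (h a b e).2, (h b e a).2]
  have k := fun m ↦ hG.bianchi hx i m e a b
  simp only [curvUp, Fin.sum_univ_three] at k ⊢
  linear_combination (G x)⁻¹ 0 j * k 0 + (G x)⁻¹ 1 j * k 1 + (G x)⁻¹ 2 j * k 2

/-- The contracted Bianchi identity `∂_e R = 2 D_a R_e^a`. -/
theorem contracted_bianchi (hG : IsLocalMetric U G) {x : E3} (hx : x ∈ U) (e : Fin 3) :
    partialDeriv e (scalOf G) x = 2 * ∑ a, (partialDeriv a (ricUp G e a) x
      + ∑ m, (gammaOf G a a m x * ricUp G e m x - gammaOf G m a e x * ricUp G m a x)) := by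
  have anti₁ (a b i j : Fin 3) : curvUp G a b i j = fun y ↦ -curvUp G b a i j y := by
    funext y
    simp only [curvUp, ← Finset.sum_neg_distrib]
    exact Finset.sum_congr rfl fun m _ ↦ by rw [curv_antisymm]; ring
  have d₁ (c a b i j : Fin 3) : partialDeriv c (curvUp G a b i j) x =
      -partialDeriv c (curvUp G b a i j) x := by
    rw [anti₁ a b i j]
    exact (hG.hasPartial (hG.curvUp_smooth b a i j) hx c).neg.2
  have d₂ (c a b i j : Fin 3) : partialDeriv c (curvUp G a b i j) x =
      -partialDeriv c (curvUp G a b j i) x :=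
    ((hG.hasPartial (hG.curvUp_smooth a b j i) hx c).neg.congr
      (by filter_upwards [hG.isOpen.mem_nhds hx] with y hy using hG.curvUp_antisymm hy a b i j)).2
  have h := Finset.sum_congr (s₁ := Finset.univ) rfl fun a _ ↦
    Finset.sum_congr (s₁ := Finset.univ) rfl fun b _ ↦ hG.bianchi_up hx e a b a b
  rw [contract_derivative_terms (fun c a b i j ↦ partialDeriv c (curvUp G a b i j) x) d₁ d₂] at h
  simp only [Finset.sum_neg_distrib] at h
  rw [contract_connection_terms (fun a b i j ↦ curvUp G a b i j x)
    (fun a b i j ↦ congrFun (anti₁ a b i j) x) (fun a b i j ↦ hG.curvUp_antisymm hx a b i j)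
    (fun k i j ↦ gammaOf G k i j x) (fun k i j ↦ by rw [hG.gamma_symm])] at h
  have hR : partialDeriv e (scalOf G) x = ∑ a, ∑ b, partialDeriv e (curvUp G a b a b) x := by
    rw [hG.scalOf_eq]
    exact (HasPartial.sum fun a ↦ .sum fun b ↦ hG.hasPartial (hG.curvUp_smooth a b a b) hx e).2
  have hr (a : Fin 3) : partialDeriv a (ricUp G e a) x =
      ∑ b, partialDeriv a (curvUp G b e b a) x :=
    (HasPartial.sum fun b ↦ hG.hasPartial (hG.curvUp_smooth b e b a) hx a).2
  rw [hR]
  simp only [hr, ricUp]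
  simp only [Finset.sum_add_distrib, Finset.sum_sub_distrib] at h ⊢
  linear_combination h

end IsLocalMetric

/-! ### Gradient, Hessian and conformal change of the curvature -/

/-- The gradient of a function, with respect to a metric given by its matrix. -/
def gradOf (G : E3 → Matrix (Fin 3) (Fin 3) ℝ) (φ : E3 → ℝ) (k : Fin 3) (x : E3) : ℝ :=
  ∑ l, (G x)⁻¹ k l * partialDeriv l φ x

/-- The Hessian `D_a D_b φ` of a function. -/
def hessOf (G : E3 → Matrix (Fin 3) (Fin 3) ℝ) (φ : E3 → ℝ) (a b : Fin 3) (x : E3) : ℝ :=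
  partialDeriv a (partialDeriv b φ) x - ∑ m, gammaOf G m a b x * partialDeriv m φ x

/-- The Hessian of a function, with its second index raised. -/
def hessUp (G : E3 → Matrix (Fin 3) (Fin 3) ℝ) (φ : E3 → ℝ) (a k : Fin 3) (x : E3) : ℝ :=
  ∑ l, (G x)⁻¹ k l * hessOf G φ a l x

/-- The squared norm of the gradient of a function. -/
def gradSq (G : E3 → Matrix (Fin 3) (Fin 3) ℝ) (φ : E3 → ℝ) (x : E3) : ℝ :=
  ∑ k, gradOf G φ k x * partialDeriv k φ x

/-- The Laplacian of a function. -/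
def laplOf (G : E3 → Matrix (Fin 3) (Fin 3) ℝ) (φ : E3 → ℝ) (x : E3) : ℝ :=
  ∑ k, hessUp G φ k k x

/-- The algebra behind the conformal change of the Ricci tensor. -/
theorem conformal_ricci_algebra (v n : Fin 3 → ℝ) (G B β : Fin 3 → Fin 3 → ℝ)
    (W : Fin 3 → Fin 3 → Fin 3 → ℝ) (hG : ∀ i j, G i j = G j i)
    (hv : ∀ i, v i = ∑ k, G i k * n k) (hB : ∀ i j, B i j = ∑ k, G j k * β i k)
    (hBs : ∀ i j, B i j = B j i)
    (hW : ∀ k i j, W k i j = (if k = j then v i else 0) + (if k = i then v j else 0) - n k * G i j)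
    (i j : Fin 3) :
    ∑ k, ((if k = j then B k i else 0) + (if k = i then B k j else 0) - β k k * G i j
        - ((if k = j then B i k else 0) + B i j - β i k * G k j)
        + ∑ m, (W k k m * W m i j - W k i m * W m k j)) =
      -B i j - (∑ k, β k k) * G i j + v i * v j - (∑ k, n k * v k) * G i j := by
  -- The factor is `1 + 3 - 1`: the middle term is the trace of the identity in dimension three.
  have t (m : Fin 3) : ∑ k, W k k m = 3 * v m := by
    simp only [hW, Finset.sum_sub_distrib, Finset.sum_add_distrib]
    rw [hv m]
    simp only [hG _ m]
    simp [mul_comm (n _)]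
    rw [← hv m]
    ring
  have l (i : Fin 3) : ∑ m, v m * W m i j = 2 * v i * v j - (∑ k, n k * v k) * G i j := by
    simp only [hW, mul_sub, mul_add, Finset.sum_sub_distrib, Finset.sum_add_distrib, mul_ite,
      mul_zero, Finset.sum_ite_eq', Finset.mem_univ, if_true, Finset.sum_mul]
    have : ∑ m, v m * (n m * G i j) = ∑ m, n m * v m * G i j :=
      Finset.sum_congr rfl fun m _ ↦ by ring
    rw [this]
    ring
  have q₁ : ∑ k, ∑ m, W k k m * W m i j = 3 * (2 * v i * v j - (∑ k, n k * v k) * G i j) := by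
    rw [Finset.sum_comm, ← l, Finset.mul_sum]
    exact Finset.sum_congr rfl fun m _ ↦ by rw [← Finset.sum_mul, t]; ring
  have nG (i : Fin 3) : ∑ k, n k * G k i = v i := by
    rw [hv]
    exact Finset.sum_congr rfl fun k _ ↦ by rw [hG, mul_comm]
  have nW (i j : Fin 3) : ∑ k, n k * W i k j = n j * 0 + (∑ k, n k * v k) * (if i = j then 1 else 0)
      + n i * v j - n i * v j := by
    simp only [hW, mul_sub, mul_add, Finset.sum_sub_distrib, Finset.sum_add_distrib, mul_ite,
      mul_zero, Finset.sum_ite_eq, Finset.mem_univ, if_true, Finset.sum_mul]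
    have : ∑ m, n m * (n i * G m j) = n i * v j := by
      rw [← nG, Finset.mul_sum]
      exact Finset.sum_congr rfl fun m _ ↦ by ring
    rw [this]
    split_ifs <;> simp
  have q₂ : ∑ k, ∑ m, W k i m * W m k j = 5 * v i * v j - 2 * (∑ k, n k * v k) * G i j := by
    have e (k m : Fin 3) : W k i m * W m k j = (if k = m then v i * W m k j else 0)
        + (if k = i then v m * W m i j else 0) - n k * W m k j * G i m := by
      rw [hW k i m]
      split_ifs with h₁ h₂ h₂
      · subst h₁; subst h₂; ring
      · subst h₁; ring
      · subst h₂; ring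
      · ring
    simp only [e, Finset.sum_sub_distrib, Finset.sum_add_distrib, Finset.sum_ite_eq,
      Finset.mem_univ, if_true]
    have s₁ : ∑ k, v i * W k k j = v i * (3 * v j) := by rw [← Finset.mul_sum, t]
    have s₂ : ∑ k, ∑ m, (if k = i then v m * W m i j else 0) = ∑ m, v m * W m i j := by
      rw [Finset.sum_comm]
      simp
    have s₃ : ∑ k, ∑ m, n k * W m k j * G i m = (∑ k, n k * v k) * G i j := by
      rw [Finset.sum_comm]
      simp only [← Finset.sum_mul, nW]
      simp
    rw [s₁, s₂, l, s₃]
    ring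
  have b : ∑ k, β i k * G k j = B i j := by
    rw [hB]
    exact Finset.sum_congr rfl fun k _ ↦ by rw [hG, mul_comm]
  simp only [Finset.sum_sub_distrib, Finset.sum_add_distrib, q₁, q₂, b, Finset.sum_ite_eq',
    Finset.mem_univ, if_true, Finset.sum_const, Finset.card_univ, Fintype.card_fin, ← Finset.sum_mul]
  rw [hBs j i]
  simp only [nsmul_eq_mul]
  push_cast
  ring

namespace IsLocalMetric

variable {U : Set E3} {G : E3 → Matrix (Fin 3) (Fin 3) ℝ} {φ : E3 → ℝ}

section Potential

theorem hasPartial_potential (hG : IsLocalMetric U G) (hφ : ContDiffOn ℝ 2 φ U) {x : E3}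
    (hx : x ∈ U) (a : Fin 3) : HasPartial a φ (partialDeriv a φ x) x :=
  .of_differentiableAt ((hφ.contDiffAt (hG.isOpen.mem_nhds hx)).differentiableAt (by simp))

/-- Splitting off the connection terms makes them cancel when scalars built from the gradient and
the Hessian are differentiated. -/
theorem hasPartial_grad (hG : IsLocalMetric U G) (hφ : ContDiffOn ℝ 2 φ U) {x : E3}
    (hx : x ∈ U) (a b : Fin 3) : HasPartial a (partialDeriv b φ)
      (hessOf G φ a b x + ∑ m, gammaOf G m a b x * partialDeriv m φ x) x := by
  have h : ContDiffOn ℝ 1 (partialDeriv b φ) U :=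
    contDiffOn_partialDeriv hG.isOpen hφ (by norm_num) b
  refine HasPartial.of_eq (.of_differentiableAt
    ((h.contDiffAt (hG.isOpen.mem_nhds hx)).differentiableAt (by simp))) ?_
  simp [hessOf]

theorem hess_symm (hG : IsLocalMetric U G) (hφ : ContDiffOn ℝ 2 φ U) {x : E3}
    (hx : x ∈ U) (a b : Fin 3) : hessOf G φ a b x = hessOf G φ b a x := by
  have := SplitSpacetime.partialDeriv_comm (F := φ) (x := x)
    (by filter_upwards [hG.isOpen.mem_nhds hx] with y hy using
      (hG.hasPartial_potential hφ hy 0).1) (fun a ↦ (hG.hasPartial_grad hφ hx a a).1) a b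
  simp only [hessOf, this, hG.gamma_symm _ a b]

theorem hasPartial_gradUp (hG : IsLocalMetric U G) (hφ : ContDiffOn ℝ 2 φ U) {x : E3}
    (hx : x ∈ U) (a k : Fin 3) : HasPartial a (gradOf G φ k)
      (hessUp G φ a k x - ∑ m, gammaOf G k a m x * gradOf G φ m x) x := by
  refine HasPartial.of_eq (.sum fun l ↦ (hG.hasPartial_inv hx a k l).mul
    (hG.hasPartial_grad hφ hx a l)) ?_
  simp only [hessUp, gradOf, Fin.sum_univ_three]
  ring

theorem lower_grad (hG : IsLocalMetric U G) {x : E3} (hx : x ∈ U) (i : Fin 3) :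
    partialDeriv i φ x = ∑ k, G x i k * gradOf G φ k x := by
  have e := fun l ↦ hG.sum_mul_inv hx i l
  have : ∑ k, G x i k * gradOf G φ k x =
      ∑ l, (∑ m, G x i m * (G x)⁻¹ m l) * partialDeriv l φ x := by
    simp only [gradOf, Fin.sum_univ_three]
    ring
  rw [this]
  simp [e]

theorem lower_hess (hG : IsLocalMetric U G) {x : E3} (hx : x ∈ U) (i j : Fin 3) :
    hessOf G φ i j x = ∑ k, G x j k * hessUp G φ i k x := by
  have e := fun l ↦ hG.sum_mul_inv hx j l
  have : ∑ k, G x j k * hessUp G φ i k x =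
      ∑ l, (∑ m, G x j m * (G x)⁻¹ m l) * hessOf G φ i l x := by
    simp only [hessUp, Fin.sum_univ_three]
    ring
  rw [this]
  simp [e]

theorem hasPartial_gradSq (hG : IsLocalMetric U G) (hφ : ContDiffOn ℝ 2 φ U) {x : E3}
    (hx : x ∈ U) (a : Fin 3) : HasPartial a (gradSq G φ)
      (2 * ∑ k, hessOf G φ a k x * gradOf G φ k x) x := by
  refine HasPartial.of_eq (.sum fun l ↦ (hG.hasPartial_gradUp hφ hx a l).mul
    (hG.hasPartial_grad hφ hx a l)) ?_
  have e := hG.inv_symm x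
  simp only [hessUp, gradOf, Fin.sum_univ_three]
  rw [e 1 0, e 2 0, e 2 1]
  ring

end Potential

section Conformal

theorem conformal_inv (hG : IsLocalMetric U G) {x : E3} (hx : x ∈ U) (k l : Fin 3) :
    (Real.exp (2 * φ x) • G x)⁻¹ k l = Real.exp (-(2 * φ x)) * (G x)⁻¹ k l := by
  have : (Real.exp (2 * φ x) • G x)⁻¹ = Real.exp (-(2 * φ x)) • (G x)⁻¹ := by
    apply Matrix.inv_eq_left_inv
    rw [Matrix.smul_mul, Matrix.mul_smul, smul_smul, ← Real.exp_add,
      Matrix.nonsing_inv_mul _ (hG.det_ne_zero x hx).isUnit]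
    simp
  rw [this, Matrix.smul_apply, smul_eq_mul]

/-- The factors `e^{2φ}` and `e^{-2φ}` cancel, and only the derivatives falling on the conformal
factor survive. -/
theorem conformal_gamma (hG : IsLocalMetric U G) (hφ : ContDiffOn ℝ 2 φ U) {x : E3}
    (hx : x ∈ U) (k i j : Fin 3) :
    gammaOf (fun y ↦ Real.exp (2 * φ y) • G y) k i j x = gammaOf G k i j x
      + ((if k = j then partialDeriv i φ x else 0) + (if k = i then partialDeriv j φ x else 0)
        - gradOf G φ k x * G x i j) := by
  have h (a b c : Fin 3) : partialDeriv a (fun y ↦ (Real.exp (2 * φ y) • G y) b c) x =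
      Real.exp (2 * φ x) * (partialDeriv a (fun y ↦ G y b c) x
        + 2 * partialDeriv a φ x * G x b c) := by
    change partialDeriv a (fun y ↦ Real.exp (2 * φ y) * G y b c) x = _
    rw [(((hG.hasPartial_potential hφ hx a).const_mul 2).exp.mul
      (hG.hasPartial (hG.smooth b c) hx a)).2]
    ring
  have e (i : Fin 3) : ∑ m, (G x)⁻¹ k m * G x i m = if k = i then 1 else 0 := by
    simp only [hG.symm x i, hG.sum_inv_mul hx]
  have e₀ : Real.exp (-(2 * φ x)) * Real.exp (2 * φ x) = 1 := by rw [← Real.exp_add]; simp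
  simp only [gammaOf, h, hG.conformal_inv hx]
  have c₁ : (if k = j then partialDeriv i φ x else 0) =
      partialDeriv i φ x * ∑ m, (G x)⁻¹ k m * G x j m := by rw [e]; simp
  have c₂ : (if k = i then partialDeriv j φ x else 0) =
      partialDeriv j φ x * ∑ m, (G x)⁻¹ k m * G x i m := by rw [e]; simp
  rw [c₁, c₂]
  simp only [gradOf]
  have k₀ (l : Fin 3) : Real.exp (-(2 * φ x)) * (G x)⁻¹ k l *
      (Real.exp (2 * φ x) * (partialDeriv i (fun y ↦ G y j l) x + 2 * partialDeriv i φ x * G x j l)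
      + Real.exp (2 * φ x) * (partialDeriv j (fun y ↦ G y i l) x + 2 * partialDeriv j φ x * G x i l)
      - Real.exp (2 * φ x) * (partialDeriv l (fun y ↦ G y i j) x
        + 2 * partialDeriv l φ x * G x i j)) =
      (G x)⁻¹ k l *
      ((partialDeriv i (fun y ↦ G y j l) x + 2 * partialDeriv i φ x * G x j l)
      + (partialDeriv j (fun y ↦ G y i l) x + 2 * partialDeriv j φ x * G x i l)
      - (partialDeriv l (fun y ↦ G y i j) x + 2 * partialDeriv l φ x * G x i j)) := by
    linear_combination (G x)⁻¹ k l *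
      ((partialDeriv i (fun y ↦ G y j l) x + 2 * partialDeriv i φ x * G x j l)
      + (partialDeriv j (fun y ↦ G y i l) x + 2 * partialDeriv j φ x * G x i l)
      - (partialDeriv l (fun y ↦ G y i j) x + 2 * partialDeriv l φ x * G x i j)) * e₀
  simp only [k₀, Fin.sum_univ_three]
  ring

/-- With `W` the difference of the two connections, the curvature changes by `D_a W_b - D_b W_a +
[W_a, W_b]`. As the metric is parallel, `D W` involves only the Hessian, and the trace is
`conformal_ricci_algebra`. -/
theorem conformal_ricci (hG : IsLocalMetric U G) (hφ : ContDiffOn ℝ 2 φ U) {x : E3}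
    (hx : x ∈ U) (i j : Fin 3) :
    ricOf (gammaOf fun y ↦ Real.exp (2 * φ y) • G y) i j x = ricOf (gammaOf G) i j x
      - hessOf G φ i j x - laplOf G φ x * G x i j + partialDeriv i φ x * partialDeriv j φ x
      - gradSq G φ x * G x i j := by
  obtain ⟨W, hW⟩ : ∃ W : Fin 3 → Fin 3 → Fin 3 → ℝ, ∀ k i j, W k i j =
      (if k = j then partialDeriv i φ x else 0) + (if k = i then partialDeriv j φ x else 0)
        - gradOf G φ k x * G x i j := ⟨_, fun _ _ _ ↦ rfl⟩
  have hd (a k i j : Fin 3) : HasPartial a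
      (gammaOf (fun y ↦ Real.exp (2 * φ y) • G y) k i j) _ x :=
    ((hG.hasPartial (hG.gamma_smooth k i j) hx a).add
      ((((hG.hasPartial_grad hφ hx a i).const_mul (if k = j then 1 else 0)).add
        ((hG.hasPartial_grad hφ hx a j).const_mul (if k = i then 1 else 0))).sub
        ((hG.hasPartial_gradUp hφ hx a k).mul (hG.hasPartial_metric hx a i j)))).congr (by
      filter_upwards [hG.isOpen.mem_nhds hx] with y hy
      rw [hG.conformal_gamma hφ hy]
      simp)
  have hΓ (k i j : Fin 3) : gammaOf (fun y ↦ Real.exp (2 * φ y) • G y) k i j x =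
      gammaOf G k i j x + W k i j := by rw [hG.conformal_gamma hφ hx, hW]
  have ΓW (k a b c : Fin 3) : ∑ m, gammaOf G k a m x * W m b c =
      gammaOf G k a c x * partialDeriv b φ x + gammaOf G k a b x * partialDeriv c φ x
        - (∑ m, gammaOf G k a m x * gradOf G φ m x) * G x b c := by
    simp only [hW, mul_sub, mul_add, Finset.sum_sub_distrib, Finset.sum_add_distrib, mul_ite,
      mul_zero, Finset.sum_ite_eq', Finset.mem_univ, if_true, Finset.sum_mul, mul_assoc]
  have WΓ (k a b c : Fin 3) : ∑ m, W k a m * gammaOf G m b c x =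
      partialDeriv a φ x * gammaOf G k b c x
        + (if k = a then 1 else 0) * (∑ m, gammaOf G m b c x * partialDeriv m φ x)
        - gradOf G φ k x * ∑ m, gammaOf G m b c x * G x a m := by
    have : ∑ m, W k a m * gammaOf G m b c x = ∑ m, (if k = m then
        partialDeriv a φ x * gammaOf G m b c x else 0)
        + (if k = a then 1 else 0) * (∑ m, gammaOf G m b c x * partialDeriv m φ x)
        - gradOf G φ k x * ∑ m, gammaOf G m b c x * G x a m := by
      simp only [hW, Finset.mul_sum, ← Finset.sum_add_distrib, ← Finset.sum_sub_distrib]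
      refine Finset.sum_congr rfl fun m _ ↦ ?_
      split_ifs <;> ring
    rw [this]
    simp
  have hc (k c a b : Fin 3) : curvOf (gammaOf fun y ↦ Real.exp (2 * φ y) • G y) k c a b x =
      curvOf (gammaOf G) k c a b x + ((if k = c then hessOf G φ a b x else 0)
        + (if k = b then hessOf G φ a c x else 0) - hessUp G φ a k x * G x b c
        - ((if k = c then hessOf G φ b a x else 0)
        + (if k = a then hessOf G φ b c x else 0) - hessUp G φ b k x * G x a c)
        + ∑ m, (W k a m * W m b c - W k b m * W m a c)) := by
    have w₁ := ΓW k a b c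
    have w₂ := ΓW k b a c
    have w₃ := WΓ k a b c
    have w₄ := WΓ k b a c
    have δ (p : Prop) [Decidable p] (r : ℝ) : (if p then r else 0) = (if p then 1 else 0) * r := by
      simp
    rw [curvOf, (hd a k b c).2, (hd b k a c).2]
    simp only [hΓ, curvOf]
    rw [δ (k = c) (hessOf G φ a b x), δ (k = c) (hessOf G φ b a x), δ (k = b) (hessOf G φ a c x),
      δ (k = a) (hessOf G φ b c x)]
    have γ₂ := fun m ↦ congrFun (hG.gamma_symm m b a) x
    have g := hG.symm x
    simp only [Fin.sum_univ_three, γ₂] at w₁ w₂ w₃ w₄ ⊢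
    simp only [g _ c] at w₁ w₂ w₃ w₄ ⊢
    linear_combination w₁ - w₂ + w₃ - w₄
  have key := conformal_ricci_algebra (fun i ↦ partialDeriv i φ x) (fun k ↦ gradOf G φ k x) (G x)
    (fun i j ↦ hessOf G φ i j x) (fun i k ↦ hessUp G φ i k x) W (hG.symm x)
    (fun i ↦ hG.lower_grad hx i) (fun i j ↦ hG.lower_hess hx i j) (fun i j ↦ hG.hess_symm hφ hx i j)
    hW i j
  simp only [ricOf, hc, if_true]
  rw [Finset.sum_add_distrib, key, laplOf, gradSq]
  ring

/-- The conformal change of the scalar curvature in dimension three. -/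
theorem conformal_scal (hG : IsLocalMetric U G) (hφ : ContDiffOn ℝ 2 φ U) {x : E3}
    (hx : x ∈ U) :
    scalOf (fun y ↦ Real.exp (2 * φ y) • G y) x =
      Real.exp (-(2 * φ x)) * (scalOf G x - 4 * laplOf G φ x - 2 * gradSq G φ x) := by
  have t : ∑ i, ∑ j, (G x)⁻¹ i j * G x i j = 3 := by
    have (i : Fin 3) : ∑ j, (G x)⁻¹ i j * G x i j = 1 := by
      simp only [hG.symm x i, hG.sum_inv_mul hx i i, if_true]
    simp [this]
  have l : ∑ i, ∑ j, (G x)⁻¹ i j * hessOf G φ i j x = laplOf G φ x := rfl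
  have q : ∑ i, ∑ j, (G x)⁻¹ i j * (partialDeriv i φ x * partialDeriv j φ x) = gradSq G φ x := by
    simp only [gradSq, gradOf, Finset.sum_mul]
    exact Finset.sum_congr rfl fun m _ ↦ Finset.sum_congr rfl fun k _ ↦ by ring
  simp only [scalOf, hG.conformal_inv hx, hG.conformal_ricci hφ hx]
  simp only [Fin.sum_univ_three] at t q l ⊢
  linear_combination Real.exp (-(2 * φ x)) * (q - l - t * (gradSq G φ x + laplOf G φ x))

end Conformal

end IsLocalMetric

/-! ### The local argument for a parallel Hessian -/

/-- A matrix with `P ^ 2 = r P`, `r > 0`, for which `r` is an eigenvalue has trace at least `r`. -/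
theorem le_trace_of_mul_self {ι : Type*} [Fintype ι] [DecidableEq ι] {P : Matrix ι ι ℝ} {r : ℝ}
    (hr : 0 < r) (hP : P * P = r • P) {n : ι → ℝ} (hn : n ≠ 0) (hPn : P.mulVec n = r • n) :
    r ≤ P.trace := by
  set Q := r⁻¹ • P with hQ
  have hQQ : IsIdempotentElem Q := by
    rw [IsIdempotentElem, hQ, Matrix.smul_mul, Matrix.mul_smul, hP, smul_smul r⁻¹ r,
      inv_mul_cancel₀ hr.ne', one_smul]
  have hlin : IsIdempotentElem (Matrix.toLin' Q) := by
    rw [IsIdempotentElem, Module.End.mul_eq_comp, ← Matrix.toLin'_mul, hQQ]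
  -- The trace of a projection is its rank, and `n` is a nonzero vector in the range.
  have htr : Q.trace = Module.finrank ℝ (LinearMap.range (Matrix.toLin' Q)) := by
    rw [← Matrix.trace_toLin'_eq]
    exact (LinearMap.isProj_range_iff_isIdempotentElem _ |>.2 hlin).trace
  have hpos : 0 < Module.finrank ℝ (LinearMap.range (Matrix.toLin' Q)) := by
    rw [Module.finrank_pos_iff_exists_ne_zero]
    refine ⟨⟨n, n, ?_⟩, fun h ↦ hn (congrArg Subtype.val h)⟩
    rw [Matrix.toLin'_apply, hQ, Matrix.smul_mulVec, hPn, smul_smul, inv_mul_cancel₀ hr.ne',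
      one_smul]
  have h1 : (1 : ℝ) ≤ Q.trace := by
    rw [htr]
    exact_mod_cast hpos
  rw [hQ, Matrix.trace_smul, smul_eq_mul, inv_mul_eq_div, le_div_iff₀ hr] at h1
  linarith

/-- The coordinate expression of a metric and of a function with parallel Hessian, whose gradient
has direction `E` and coefficient `f`, such that the Ricci tensor has the eigendirection `E` and is
isotropic across it, and such that the conformal change of the metric by the function has constant
scalar curvature `C`. -/
structure IsLocalModel (U : Set E3) (G : E3 → Matrix (Fin 3) (Fin 3) ℝ) (φ : E3 → ℝ)
    (E : Fin 3 → E3 → ℝ) (f : E3 → ℝ) (C : ℝ) : Prop where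
  metric : IsLocalMetric U G
  potential : ContDiffOn ℝ 2 φ U
  parallel : ∀ x ∈ U, ∀ c a b, HasPartial c (hessOf G φ a b)
    (∑ m, (gammaOf G m c a x * hessOf G φ m b x + gammaOf G m c b x * hessOf G φ a m x)) x
  grad_eq : ∀ x ∈ U, ∀ i, partialDeriv i φ x = f x * E i x
  unit : ∀ x ∈ U, ∑ i, (∑ j, (G x)⁻¹ i j * E j x) * E i x = 1
  ricci : ∀ x ∈ U, ∃ α β : ℝ, ∀ i j, ricOf (gammaOf G) i j x =
    α * (E i x * E j x) + β * (G x i j - E i x * E j x)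
  scal : ∀ x ∈ U, scalOf (fun y ↦ Real.exp (2 * φ y) • G y) x = C

/-- The covector `B n`, for the Hessian `B` and the gradient `n` of a function. -/
def hessGrad (G : E3 → Matrix (Fin 3) (Fin 3) ℝ) (φ : E3 → ℝ) (a : Fin 3) (x : E3) : ℝ :=
  ∑ k, hessOf G φ a k x * gradOf G φ k x

/-- The Hessian of a function evaluated on its gradient. -/
def hessGradGrad (G : E3 → Matrix (Fin 3) (Fin 3) ℝ) (φ : E3 → ℝ) (x : E3) : ℝ :=
  ∑ a, gradOf G φ a x * hessGrad G φ a x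

namespace IsLocalModel

variable {U : Set E3} {G : E3 → Matrix (Fin 3) (Fin 3) ℝ} {φ : E3 → ℝ}
  {E : Fin 3 → E3 → ℝ} {f : E3 → ℝ} {C : ℝ} {x : E3}

theorem mem_nhds (h : IsLocalModel U G φ E f C) (hx : x ∈ U) : U ∈ 𝓝 x :=
  h.metric.isOpen.mem_nhds hx

/-- Ricci identity: the third covariant derivatives vanish, so their commutator, the curvature
applied to `dφ`, vanishes too. Parallelism supplies the differentiability of `∂_b ∂_c φ` that `C²`
alone would not. -/
theorem sum_grad_mul_curv (h : IsLocalModel U G φ E f C) (hx : x ∈ U) (c a b : Fin 3) :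
    ∑ m, partialDeriv m φ x * curvOf (gammaOf G) m c a b x = 0 := by
  have hG := h.metric
  have hd (a b : Fin 3) : HasPartial a (partialDeriv b (partialDeriv c φ)) _ x :=
    ((h.parallel x hx a b c).add (.sum fun m ↦ (hG.hasPartial (hG.gamma_smooth m b c) hx a).mul
      (hG.hasPartial_grad h.potential hx a m))).congr (by
      filter_upwards [h.mem_nhds hx] with y hy
      exact (hG.hasPartial_grad h.potential hy b c).2)
  have hs := SplitSpacetime.partialDeriv_comm (F := partialDeriv c φ) (x := x)
    (by filter_upwards [h.mem_nhds hx] with y hy using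
      (hG.hasPartial_grad h.potential hy c c).1) (fun a ↦ (hd a a).1) a b
  rw [(hd a b).2, (hd b a).2] at hs
  have γ := fun m ↦ congrFun (hG.gamma_symm m b a) x
  simp only [curvOf, Fin.sum_univ_three, γ] at hs ⊢
  linear_combination hs

/-- Antisymmetry of the curvature moves the gradient to the other slot. -/
theorem sum_curv_mul_gradUp (h : IsLocalModel U G φ E f C) (hx : x ∈ U) (i a b : Fin 3) :
    ∑ m, curvOf (gammaOf G) i m a b x * gradOf G φ m x = 0 := by
  have e₁ : ∑ m, curvOf (gammaOf G) i m a b x * gradOf G φ m x =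
      ∑ j, curvUp G a b i j x * partialDeriv j φ x := by
    simp only [gradOf, curvUp, Fin.sum_univ_three]
    ring
  have e₂ : ∑ j, curvUp G a b j i x * partialDeriv j φ x = ∑ m, (∑ j, partialDeriv j φ x *
      curvOf (gammaOf G) j m a b x) * (G x)⁻¹ m i := by
    simp only [curvUp, Fin.sum_univ_three]
    ring
  rw [e₁, Finset.sum_congr rfl fun j _ ↦ by rw [h.metric.curvUp_antisymm hx a b i j, neg_mul],
    Finset.sum_neg_distrib, e₂]
  simp [h.sum_grad_mul_curv hx]

theorem sum_ric_mul_gradUp (h : IsLocalModel U G φ E f C) (hx : x ∈ U) (i : Fin 3) :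
    ∑ j, ricOf (gammaOf G) i j x * gradOf G φ j x = 0 := by
  simp only [ricOf, Finset.sum_mul]
  rw [Finset.sum_comm]
  exact Finset.sum_eq_zero fun k _ ↦ h.sum_curv_mul_gradUp hx k k i

theorem gradOf_eq (h : IsLocalModel U G φ E f C) (hx : x ∈ U) (k : Fin 3) :
    gradOf G φ k x = f x * ∑ j, (G x)⁻¹ k j * E j x := by
  simp only [gradOf, h.grad_eq x hx, Finset.mul_sum]
  exact Finset.sum_congr rfl fun j _ ↦ by ring

theorem gradSq_eq (h : IsLocalModel U G φ E f C) (hx : x ∈ U) : gradSq G φ x = f x ^ 2 := by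
  have e : gradSq G φ x = f x ^ 2 * ∑ i, (∑ j, (G x)⁻¹ i j * E j x) * E i x := by
    simp only [gradSq, h.gradOf_eq hx, h.grad_eq x hx, Finset.mul_sum (a := f x ^ 2)]
    exact Finset.sum_congr rfl fun j _ ↦ by ring
  rw [e, h.unit x hx, mul_one]

/-- The gradient is a nonzero multiple of the eigendirection with eigenvalue `α` and is killed by
the Ricci tensor, so `α = 0`; the trace then gives `R = 2 β`. -/
theorem ric_eq (h : IsLocalModel U G φ E f C) (hx : x ∈ U) (hf : f x ≠ 0) (i j : Fin 3) :
    ricOf (gammaOf G) i j x =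
      scalOf G x / 2 * (G x i j - partialDeriv i φ x * partialDeriv j φ x / gradSq G φ x) := by
  obtain ⟨α, β, hαβ⟩ := h.ricci x hx
  have hu := h.unit x hx
  have hα : α = 0 := by
    have hz (i : Fin 3) : α * E i x = 0 := by
      have h₁ := h.sum_ric_mul_gradUp hx i
      have h₂ := h.metric.lower_grad (φ := φ) hx i
      rw [h.grad_eq x hx] at h₂
      have h₃ : ∑ j, E j x * gradOf G φ j x = f x := by
        have : ∑ j, E j x * gradOf G φ j x =
            f x * ∑ i, (∑ j, (G x)⁻¹ i j * E j x) * E i x := by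
          rw [Finset.mul_sum]
          exact Finset.sum_congr rfl fun j _ ↦ by rw [h.gradOf_eq hx]; ring
        rw [this, hu, mul_one]
      simp only [hαβ] at h₁
      have h₄ : ∑ j, (α * (E i x * E j x) + β * (G x i j - E i x * E j x)) * gradOf G φ j x =
          (α - β) * E i x * (∑ j, E j x * gradOf G φ j x)
            + β * ∑ j, G x i j * gradOf G φ j x := by
        simp only [Fin.sum_univ_three]
        ring
      rw [h₄, h₃, ← h₂] at h₁
      have : (α * E i x) * f x = 0 := by linear_combination h₁
      exact (mul_eq_zero.1 this).resolve_right hf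
    have : α * ∑ i, (∑ j, (G x)⁻¹ i j * E j x) * E i x = 0 := by
      rw [Finset.mul_sum]
      refine Finset.sum_eq_zero fun i _ ↦ ?_
      linear_combination (∑ j, (G x)⁻¹ i j * E j x) * hz i
    rwa [hu, mul_one] at this
  have hβ : scalOf G x = 2 * β := by
    have t : ∑ i, ∑ j, (G x)⁻¹ i j * G x i j = 3 := by
      have (i : Fin 3) : ∑ j, (G x)⁻¹ i j * G x i j = 1 := by
        simp only [h.metric.symm x i, h.metric.sum_inv_mul hx i i, if_true]
      simp [this]
    simp only [scalOf, hαβ, hα, Fin.sum_univ_three] at t hu ⊢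
    linear_combination β * t - β * hu
  rw [hαβ, hα, hβ, h.gradSq_eq hx, h.grad_eq x hx, h.grad_eq x hx]
  field_simp
  ring

theorem hess_symm (h : IsLocalModel U G φ E f C) (hx : x ∈ U) (a b : Fin 3) :
    hessOf G φ a b x = hessOf G φ b a x := h.metric.hess_symm h.potential hx a b

theorem hasPartial_gradSq (h : IsLocalModel U G φ E f C) (hx : x ∈ U) (a : Fin 3) :
    HasPartial a (gradSq G φ) (2 * hessGrad G φ a x) x :=
  h.metric.hasPartial_gradSq h.potential hx a

theorem hasPartial_scal (h : IsLocalModel U G φ E f C) (hx : x ∈ U) (a : Fin 3) :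
    HasPartial a (scalOf G) (partialDeriv a (scalOf G) x) x :=
  h.metric.hasPartial h.metric.scal_smooth hx a

theorem gradSq_ne_zero (h : IsLocalModel U G φ E f C) (hx : x ∈ U) (hf : f x ≠ 0) :
    gradSq G φ x ≠ 0 := by
  rw [h.gradSq_eq hx]
  positivity

/-- Continuity is taken from `|∇φ|² = f²`, since none is assumed of `f` itself. -/
theorem eventually_ne (h : IsLocalModel U G φ E f C) (hx : x ∈ U) (hf : f x ≠ 0) :
    ∀ᶠ y in 𝓝 x, y ∈ U ∧ f y ≠ 0 := by
  filter_upwards [h.mem_nhds hx, (h.hasPartial_gradSq hx 0).1.continuousAt.eventually_ne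
    (h.gradSq_ne_zero hx hf)] with y hy hy'
  refine ⟨hy, fun h0 ↦ hy' ?_⟩
  rw [h.gradSq_eq hy, h0]
  ring

/-- The contracted Bianchi identity, where the gradient does not vanish. -/
theorem bianchi_grad (h : IsLocalModel U G φ E f C) (hx : x ∈ U) (hf : f x ≠ 0) (e : Fin 3) :
    (∑ a, gradOf G φ a x * partialDeriv a (fun y ↦ scalOf G y / gradSq G φ y) x
      + scalOf G x / gradSq G φ x * laplOf G φ x) * partialDeriv e φ x
      + scalOf G x / gradSq G φ x * hessGrad G φ e x = 0 := by
  have hG := h.metric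
  -- The mixed Ricci tensor is `(1/2)(R δ - (R/q) n ⊗ n)`. Its divergence contains `∂_e R / 2`,
  -- which cancels the left side of the contracted Bianchi identity.
  have hup {y : E3} (hy : y ∈ U) (hfy : f y ≠ 0) (e a : Fin 3) : ricUp G e a y =
      1 / 2 * ((if e = a then 1 else 0) * scalOf G y
        - scalOf G y / gradSq G φ y * (partialDeriv e φ y * gradOf G φ a y)) := by
    rw [ricUp_eq]
    simp only [h.ric_eq hy hfy, ← hG.sum_mul_inv hy e a]
    simp only [gradOf, hG.inv_symm y a, Fin.sum_univ_three]
    ring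
  have hρ (a : Fin 3) : HasPartial a (fun y ↦ scalOf G y / gradSq G φ y)
      (partialDeriv a (fun y ↦ scalOf G y / gradSq G φ y) x) x := .of_differentiableAt
    ((h.hasPartial_scal hx a).div (h.hasPartial_gradSq hx a) (h.gradSq_ne_zero hx hf)).1
  have hd (a : Fin 3) : HasPartial a (ricUp G e a) _ x :=
    ((((h.hasPartial_scal hx a).const_mul (if e = a then 1 else 0)).sub ((hρ a).mul
      ((hG.hasPartial_grad h.potential hx a e).mul
        (hG.hasPartial_gradUp h.potential hx a a)))).const_mul (1 / 2)).congr (by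
      filter_upwards [h.eventually_ne hx hf] with y hy using hup hy.1 hy.2 e a)
  have key := hG.contracted_bianchi hx e
  simp only [hup hx hf, fun a ↦ (hd a).2] at key
  have B := fun a ↦ h.hess_symm hx e a
  have γ := fun m a ↦ congrFun (hG.gamma_symm m a e) x
  simp only [laplOf, hessGrad, B, γ] at key ⊢
  obtain rfl | rfl | rfl : e = 0 ∨ e = 1 ∨ e = 2 := by fin_cases e <;> simp
  all_goals
    simp only [Fin.sum_univ_three, Fin.reduceEq, if_true, if_false, one_mul, zero_mul] at key ⊢
    have γ₁ := fun k ↦ congrFun (hG.gamma_symm k 1 0) x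
    have γ₂ := fun k ↦ congrFun (hG.gamma_symm k 2 0) x
    have γ₃ := fun k ↦ congrFun (hG.gamma_symm k 2 1) x
    simp only [γ₁, γ₂, γ₃] at key
    linear_combination key

theorem hessGrad_eq (h : IsLocalModel U G φ E f C) (hx : x ∈ U) (hf : f x ≠ 0)
    (hR : scalOf G x ≠ 0) (e : Fin 3) :
    hessGrad G φ e x = hessGradGrad G φ x / gradSq G φ x * partialDeriv e φ x := by
  have hq := h.gradSq_ne_zero hx hf
  obtain ⟨μ, hμ⟩ : ∃ μ, ∀ e, hessGrad G φ e x = μ * partialDeriv e φ x := by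
    refine ⟨-(∑ a, gradOf G φ a x * partialDeriv a (fun y ↦ scalOf G y / gradSq G φ y) x
      + scalOf G x / gradSq G φ x * laplOf G φ x) / (scalOf G x / gradSq G φ x), fun e ↦ ?_⟩
    have hr : scalOf G x / gradSq G φ x ≠ 0 := div_ne_zero hR hq
    rw [div_mul_eq_mul_div, eq_div_iff hr]
    linear_combination h.bianchi_grad hx hf e
  have : hessGradGrad G φ x = μ * gradSq G φ x := by
    simp only [hessGradGrad, gradSq, hμ, Finset.mul_sum]
    exact Finset.sum_congr rfl fun k _ ↦ by ring
  rw [hμ, this]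
  field_simp

/-- Pair `bianchi_grad` with the gradient and expand the derivative of `R/q` using `dq = 2 B n`. -/
theorem grad_scal_of_bianchi (h : IsLocalModel U G φ E f C) (hx : x ∈ U) (hf : f x ≠ 0) :
    ∑ a, gradOf G φ a x * partialDeriv a (scalOf G) x =
      -scalOf G x * (laplOf G φ x - hessGradGrad G φ x / gradSq G φ x) := by
  have hq := h.gradSq_ne_zero hx hf
  have hρ (a : Fin 3) := (h.hasPartial_scal hx a).div (h.hasPartial_gradSq hx a) hq
  have hs : (∑ a, gradOf G φ a x * partialDeriv a (fun y ↦ scalOf G y / gradSq G φ y) x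
      + scalOf G x / gradSq G φ x * laplOf G φ x) * gradSq G φ x
      + scalOf G x / gradSq G φ x * hessGradGrad G φ x = 0 := by
    simp only [gradSq, hessGradGrad, Finset.mul_sum, ← Finset.sum_add_distrib]
    refine Finset.sum_eq_zero fun e _ ↦ ?_
    have := h.bianchi_grad hx hf e
    simp only [gradSq] at this
    linear_combination gradOf G φ e x * this
  have hsum : ∑ a, gradOf G φ a x * partialDeriv a (fun y ↦ scalOf G y / gradSq G φ y) x =
      ((∑ a, gradOf G φ a x * partialDeriv a (scalOf G) x) * gradSq G φ x
        - 2 * scalOf G x * hessGradGrad G φ x) / gradSq G φ x ^ 2 := by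
    simp only [fun a ↦ (hρ a).2, hessGradGrad, Fin.sum_univ_three]
    ring
  rw [hsum] at hs
  field_simp at hs ⊢
  linear_combination hs

theorem scal_eq (h : IsLocalModel U G φ E f C) (hx : x ∈ U) :
    scalOf G x = 4 * laplOf G φ x + 2 * gradSq G φ x + C * Real.exp (2 * φ x) := by
  have h₁ := h.scal x hx
  rw [h.metric.conformal_scal h.potential hx] at h₁
  have h₂ : Real.exp (-(2 * φ x)) * Real.exp (2 * φ x) = 1 := by rw [← Real.exp_add]; simp
  linear_combination Real.exp (2 * φ x) * h₁
    - (scalOf G x - 4 * laplOf G φ x - 2 * gradSq G φ x) * h₂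

/-- The trace of a parallel tensor is constant: the connection terms cancel. -/
theorem hasPartial_lapl (h : IsLocalModel U G φ E f C) (hx : x ∈ U) (a : Fin 3) :
    HasPartial a (laplOf G φ) 0 x := by
  refine HasPartial.of_eq (.sum fun k ↦ .sum fun l ↦ (h.metric.hasPartial_inv hx a k l).mul
    (h.parallel x hx a k l)) ?_
  simp only [Fin.sum_univ_three]
  ring

theorem partialDeriv_scal (h : IsLocalModel U G φ E f C) (hx : x ∈ U) (a : Fin 3) :
    partialDeriv a (scalOf G) x =
      4 * hessGrad G φ a x + 2 * C * Real.exp (2 * φ x) * partialDeriv a φ x := by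
  have hd : HasPartial a (scalOf G) _ x :=
    ((((h.hasPartial_lapl hx a).const_mul 4).add ((h.hasPartial_gradSq hx a).const_mul 2)).add
    (((h.metric.hasPartial_potential h.potential hx a).const_mul 2).exp.const_mul C)).congr (by
      filter_upwards [h.mem_nhds hx] with y hy using h.scal_eq hy)
  rw [hd.2]
  ring

theorem grad_scal (h : IsLocalModel U G φ E f C) (hx : x ∈ U) :
    ∑ a, gradOf G φ a x * partialDeriv a (scalOf G) x =
      4 * hessGradGrad G φ x + 2 * C * Real.exp (2 * φ x) * gradSq G φ x := by
  simp only [h.partialDeriv_scal hx, hessGradGrad, gradSq, Fin.sum_univ_three]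
  ring

theorem hasPartial_hessGrad (h : IsLocalModel U G φ E f C) (hx : x ∈ U) (c a : Fin 3) :
    HasPartial c (hessGrad G φ a) (∑ m, gammaOf G m c a x * hessGrad G φ m x
      + ∑ k, hessOf G φ a k x * hessUp G φ c k x) x := by
  refine HasPartial.of_eq (.sum fun k ↦ (h.parallel x hx c a k).mul
    (h.metric.hasPartial_gradUp h.potential hx c k)) ?_
  simp only [hessGrad, Fin.sum_univ_three]
  ring

theorem differentiableAt_hessGradGrad (h : IsLocalModel U G φ E f C) (hx : x ∈ U) :
    DifferentiableAt ℝ (hessGradGrad G φ) x :=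
  (HasPartial.sum (a := 0) fun k ↦ (h.metric.hasPartial_gradUp h.potential hx 0 k).mul
    (h.hasPartial_hessGrad hx 0 k)).1

/-- Differentiate `B n = λ n`, which holds near `x`. As `B` is parallel this gives `B² = dλ ⊗ n + λ
B`; applying it to `n`, where both `B²` and `λ B` give `λ² n`, forces `dλ = 0`. -/
theorem sum_hess_mul_hessUp (h : IsLocalModel U G φ E f C) (hx : x ∈ U) (hf : f x ≠ 0)
    (hR : scalOf G x ≠ 0) (a c : Fin 3) :
    ∑ k, hessOf G φ a k x * hessUp G φ c k x =
      hessGradGrad G φ x / gradSq G φ x * hessOf G φ c a x := by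
  have hq := h.gradSq_ne_zero hx hf
  obtain ⟨lam, hlam⟩ : ∃ lam : E3 → ℝ, lam = fun y ↦ hessGradGrad G φ y / gradSq G φ y := ⟨_, rfl⟩
  have hl (c : Fin 3) : HasPartial c lam (partialDeriv c lam x) x := by
    refine .of_differentiableAt ?_
    rw [hlam]
    exact ((HasPartial.of_differentiableAt (a := 0) (h.differentiableAt_hessGradGrad hx)).div
      (h.hasPartial_gradSq hx 0) hq).1
  have he : ∀ y, y ∈ U → f y ≠ 0 → scalOf G y ≠ 0 → ∀ e,
      hessGrad G φ e y = lam y * partialDeriv e φ y := by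
    intro y hy hfy hRy e
    rw [hlam]
    exact h.hessGrad_eq hy hfy hRy e
  have hev : ∀ᶠ y in 𝓝 x, scalOf G y ≠ 0 :=
    (h.hasPartial_scal hx 0).1.continuousAt.eventually_ne hR
  have hd (c a : Fin 3) : HasPartial c (hessGrad G φ a) _ x :=
    ((hl c).mul (h.metric.hasPartial_grad h.potential hx c a)).congr (by
      filter_upwards [h.eventually_ne hx hf, hev] with y hy hRy using he y hy.1 hy.2 hRy a)
  have e₁ (c a : Fin 3) : ∑ k, hessOf G φ a k x * hessUp G φ c k x =
      partialDeriv c lam x * partialDeriv a φ x + lam x * hessOf G φ c a x := by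
    have := (h.hasPartial_hessGrad hx c a).unique (hd c a)
    simp only [he x hx hf hR] at this
    have e : ∑ m, gammaOf G m c a x * (lam x * partialDeriv m φ x) =
        lam x * ∑ m, gammaOf G m c a x * partialDeriv m φ x := by
      rw [Finset.mul_sum]
      exact Finset.sum_congr rfl fun m _ ↦ by ring
    rw [e] at this
    linear_combination this
  have e₂ (c : Fin 3) : ∑ a, gradOf G φ a x * ∑ k, hessOf G φ a k x * hessUp G φ c k x =
      lam x * (lam x * partialDeriv c φ x) := by
    have hs := h.hess_symm hx
    have e₃ : ∑ a, gradOf G φ a x * ∑ k, hessOf G φ a k x * hessUp G φ c k x =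
        ∑ k, hessGrad G φ k x * hessUp G φ c k x := by
      simp only [hessGrad, Finset.mul_sum, Finset.sum_mul]
      rw [Finset.sum_comm]
      exact Finset.sum_congr rfl fun k _ ↦ Finset.sum_congr rfl fun a _ ↦ by
        rw [hs a k]; ring
    have e₄ : ∑ k, lam x * partialDeriv k φ x * hessUp G φ c k x = lam x * hessGrad G φ c x := by
      have i := h.metric.inv_symm x
      simp only [hessGrad, hessUp, gradOf, Fin.sum_univ_three]
      rw [i 1 0, i 2 0, i 2 1]
      ring
    rw [e₃, Finset.sum_congr rfl fun k _ ↦ by rw [he x hx hf hR k], e₄, he x hx hf hR]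
  have e₅ (c : Fin 3) : partialDeriv c lam x = 0 := by
    have h₂ := e₂ c
    simp only [e₁] at h₂
    have h₃ : ∑ a, gradOf G φ a x * (partialDeriv c lam x * partialDeriv a φ x
        + lam x * hessOf G φ c a x) =
        partialDeriv c lam x * gradSq G φ x + lam x * hessGrad G φ c x := by
      simp only [gradSq, hessGrad, Fin.sum_univ_three]
      ring
    rw [h₃, he x hx hf hR] at h₂
    have : partialDeriv c lam x * gradSq G φ x = 0 := by linear_combination h₂
    exact (mul_eq_zero.1 this).resolve_right hq
  rw [e₁, e₅, hlam]
  ring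

/-- The endomorphism `B` satisfies `B² = λ B` and `B n = λ n` with `λ > 0`, so its trace is `λ`
times a positive rank. -/
theorem le_lapl (h : IsLocalModel U G φ E f C) (hx : x ∈ U) (hf : f x ≠ 0)
    (hR : scalOf G x ≠ 0) (hs : 0 < hessGradGrad G φ x / gradSq G φ x) :
    hessGradGrad G φ x / gradSq G φ x ≤ laplOf G φ x := by
  have e (k : Fin 3) (w : Fin 3 → ℝ) : ∑ c, hessUp G φ c k x * w c =
      ∑ l, (G x)⁻¹ k l * ∑ c, hessOf G φ l c x * w c := by
    simp only [hessUp, Finset.mul_sum, Finset.sum_mul]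
    rw [Finset.sum_comm]
    exact Finset.sum_congr rfl fun l _ ↦ Finset.sum_congr rfl fun c _ ↦ by
      rw [h.hess_symm hx c l]; ring
  refine le_trace_of_mul_self (P := Matrix.of fun k c ↦ hessUp G φ c k x) hs ?_
    (n := fun k ↦ gradOf G φ k x) ?_ ?_
  · ext k d
    simp only [Matrix.mul_apply, Matrix.of_apply, Matrix.smul_apply, smul_eq_mul, e k,
      h.sum_hess_mul_hessUp hx hf hR]
    rw [hessUp, Finset.mul_sum]
    exact Finset.sum_congr rfl fun l _ ↦ by ring
  · intro h0
    refine h.gradSq_ne_zero hx hf (Finset.sum_eq_zero fun k _ ↦ ?_)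
    rw [congrFun h0 k]
    simp
  · ext k
    simp only [Matrix.mulVec, dotProduct, Matrix.of_apply, Pi.smul_apply, smul_eq_mul, e k]
    change ∑ l, (G x)⁻¹ k l * hessGrad G φ l x = _
    simp only [h.hessGrad_eq hx hf hR]
    rw [gradOf, Finset.mul_sum]
    exact Finset.sum_congr rfl fun l _ ↦ by ring

/-- If `B(n,n) > 0`, then `Δφ ≥ λ > 0` and so `R > 0`. The derivative of `R` along `n` is then
nonpositive by Bianchi but positive by the conformal law. -/
theorem hessGradGrad_nonpos_of_scal_ne_zero (h : IsLocalModel U G φ E f C) (hC : 0 ≤ C)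
    (hx : x ∈ U) (hf : f x ≠ 0) (hR : scalOf G x ≠ 0) : hessGradGrad G φ x ≤ 0 := by
  by_contra! hs
  have hq : 0 < gradSq G φ x := by rw [h.gradSq_eq hx]; positivity
  have hlam := div_pos hs hq
  have hle := h.le_lapl hx hf hR hlam
  have hexp : 0 ≤ C * Real.exp (2 * φ x) := by positivity
  have hRp : 0 < scalOf G x := by rw [h.scal_eq hx]; linarith
  have h₁ := h.grad_scal hx
  rw [h.grad_scal_of_bianchi hx hf] at h₁
  have h₂ : 0 ≤ scalOf G x * (laplOf G φ x - hessGradGrad G φ x / gradSq G φ x) :=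
    mul_nonneg hRp.le (by linarith)
  have h₃ : 0 ≤ C * Real.exp (2 * φ x) * gradSq G φ x := mul_nonneg hexp hq.le
  linarith

theorem hessGradGrad_nonpos (h : IsLocalModel U G φ E f C) (hC : 0 ≤ C)
    (hx : x ∈ U) (hf : f x ≠ 0) : hessGradGrad G φ x ≤ 0 := by
  by_cases hR : ∀ᶠ y in 𝓝 x, scalOf G y = 0
  · have hz (a : Fin 3) : partialDeriv a (scalOf G) x = 0 := ((HasPartial.const 0).congr hR).2
    have h₁ := h.grad_scal hx
    simp only [hz, mul_zero, Finset.sum_const_zero] at h₁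
    have hq : 0 ≤ gradSq G φ x := by rw [h.gradSq_eq hx]; positivity
    have : 0 ≤ C * Real.exp (2 * φ x) * gradSq G φ x := by positivity
    linarith
  · by_contra! hs
    -- Positivity of `B(n,n)` persists nearby, so every nearby point with `R ≠ 0` is excluded by the
    -- previous case and `R` would vanish locally after all.
    refine hR ?_
    filter_upwards [h.eventually_ne hx hf,
      (h.differentiableAt_hessGradGrad hx).continuousAt.eventually_const_lt hs] with y hy hsy
    by_contra hRy
    exact absurd (h.hessGradGrad_nonpos_of_scal_ne_zero hC hy.1 hy.2 hRy) (not_le.2 hsy)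

/-- The coefficient is recovered as `e^i ∂_i φ`, one order less regular than `φ`. -/
theorem contDiffOn_coeff (h : IsLocalModel U G φ E f C) (hE : ∀ i, ContDiffOn ℝ ∞ (E i) U) :
    ContDiffOn ℝ 1 f U := by
  have hs : ContDiffOn ℝ 1 (fun x ↦ ∑ i, (∑ j, (G x)⁻¹ i j * E j x) * partialDeriv i φ x) U :=
    ContDiffOn.sum fun i _ ↦ (ContDiffOn.sum fun j _ ↦ ((h.metric.inv_smooth i j).of_le
      (by simp)).mul ((hE j).of_le (by simp))).mul
      (contDiffOn_partialDeriv h.metric.isOpen h.potential (by norm_num) i)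
  refine hs.congr fun x hx ↦ ?_
  have : ∑ i, (∑ j, (G x)⁻¹ i j * E j x) * partialDeriv i φ x =
      f x * ∑ i, (∑ j, (G x)⁻¹ i j * E j x) * E i x := by
    simp only [h.grad_eq x hx]
    rw [Finset.mul_sum]
    exact Finset.sum_congr rfl fun i _ ↦ by ring
  rw [this, h.unit x hx, mul_one]

/-- The derivative of the coefficient of the gradient along its direction is nonpositive. -/
theorem sum_partialDeriv_coeff_nonpos (h : IsLocalModel U G φ E f C)
    (hE : ∀ i, ContDiffOn ℝ ∞ (E i) U) (hC : 0 ≤ C) (hx : x ∈ U) :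
    ∑ i, (∑ j, (G x)⁻¹ i j * E j x) * partialDeriv i f x ≤ 0 := by
  have hf := h.contDiffOn_coeff hE
  have hF : ContDiffOn ℝ 0 (fun x ↦ ∑ i, (∑ j, (G x)⁻¹ i j * E j x) * partialDeriv i f x) U :=
    ContDiffOn.sum fun i _ ↦ (ContDiffOn.sum fun j _ ↦ ((h.metric.inv_smooth i j).of_le
      (by simp)).mul ((hE j).of_le (by simp))).mul
      (contDiffOn_partialDeriv h.metric.isOpen hf (by norm_num) i)
  -- Differentiating `q = f²` gives `B n = f df`, hence `B(n,n) = f² e(f)`, and `f²` can be divided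
  -- out.
  have key : ∀ y ∈ U, f y ≠ 0 →
      ∑ i, (∑ j, (G y)⁻¹ i j * E j y) * partialDeriv i f y ≤ 0 := by
    intro y hy hfy
    have hfd (a : Fin 3) : HasPartial a f (partialDeriv a f y) y := .of_differentiableAt
      ((hf.contDiffAt (h.mem_nhds hy)).differentiableAt (by simp))
    have e (a : Fin 3) : hessGrad G φ a y = f y * partialDeriv a f y := by
      have h₁ : HasPartial a (gradSq G φ) _ y := ((hfd a).mul (hfd a)).congr (by
        filter_upwards [h.mem_nhds hy] with z hz
        rw [h.gradSq_eq hz, sq])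
      linarith [(h.hasPartial_gradSq hy a).unique h₁]
    have hs : hessGradGrad G φ y =
        f y ^ 2 * ∑ i, (∑ j, (G y)⁻¹ i j * E j y) * partialDeriv i f y := by
      rw [hessGradGrad, Finset.mul_sum]
      exact Finset.sum_congr rfl fun i _ ↦ by rw [h.gradOf_eq hy, e]; ring
    have hn := h.hessGradGrad_nonpos hC hy hfy
    rw [hs] at hn
    have : 0 < f y ^ 2 := by positivity
    by_contra! hc
    exact absurd hn (not_le.2 (mul_pos this hc))
  by_contra! hpos
  have hev := (hF.continuousOn.continuousAt (h.mem_nhds hx)).eventually_const_lt hpos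
  -- If `e(f) > 0` at `x`, then by continuity it is positive nearby, where `f` must therefore
  -- vanish; but then `df = 0` at `x`.
  have hz : ∀ᶠ y in 𝓝 x, f y = 0 := by
    filter_upwards [hev, h.mem_nhds hx] with y hy hyU
    by_contra hfy
    exact absurd (key y hyU hfy) (not_le.2 hy)
  have hd (a : Fin 3) : partialDeriv a f x = 0 := ((HasPartial.const 0).congr hz).2
  simp [hd] at hpos

end IsLocalModel

/-! ### From the manifold to charts -/

section Charts

variable {T : Type*} [TopologicalSpace T] [ChartedSpace E3 T]
  {c : OpenPartialHomeomorph T E3} {x : E3}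

theorem mdifferentiableAt_symm (hc : c ∈ IsManifold.maximalAtlas (𝓡 3) ∞ T) (hx : x ∈ c.target) :
    MDifferentiableAt 𝓘(ℝ, E3) (𝓡 3) c.symm x :=
  (contMDiffAt_symm_of_mem_maximalAtlas hc hx).mdifferentiableAt (by simp)

theorem mdifferentiable_chart (hc : c ∈ IsManifold.maximalAtlas (𝓡 3) ∞ T) :
    c.MDifferentiable (𝓡 3) 𝓘(ℝ, E3) :=
  ⟨(contMDiffOn_of_mem_maximalAtlas hc).mdifferentiableOn (by simp),
    (contMDiffOn_symm_of_mem_maximalAtlas hc).mdifferentiableOn (by simp)⟩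

theorem mfderiv_symm_eq_sum (c : OpenPartialHomeomorph T E3) (x w : E3) :
    mfderiv 𝓘(ℝ, E3) (𝓡 3) c.symm x w = ∑ i, w i • coordVec c i x := by
  conv_lhs => rw [sum_smul_single w]
  exact (map_sum _ _ _).trans (Finset.sum_congr rfl fun i _ ↦ map_smul _ _ _)

theorem iterCovDeriv_two (g : ∀ p : T, TangentSpace (𝓡 3) p →L[ℝ] TangentSpace (𝓡 3) p →L[ℝ] ℝ)
    (c : OpenPartialHomeomorph T E3) (φ : T → ℝ) (a : Fin 2 → Fin 3) :
    iterCovDeriv g c φ 2 a = hessOf (metricMatrix g c) (φ ∘ c.symm) (a 0) (a 1) := by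
  have h₁ (b : Fin 1 → Fin 3) : iterCovDeriv g c φ 1 b = partialDeriv (b 0) (φ ∘ c.symm) := by
    funext y
    simp only [iterCovDeriv, covDeriv, Finset.univ_eq_empty, Finset.sum_empty, sub_zero]
    rfl
  funext y
  rw [iterCovDeriv, covDeriv, h₁]
  simp only [h₁, hessOf, Finset.univ_unique, Finset.sum_singleton, christoffel_eq_gammaOf]
  rfl

theorem mfderiv_symm_injective (hc : c ∈ IsManifold.maximalAtlas (𝓡 3) ∞ T) (hx : x ∈ c.target) :
    Function.Injective (mfderiv 𝓘(ℝ, E3) (𝓡 3) c.symm x) := by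
  intro v w hvw
  have h := (mdifferentiable_chart hc).comp_symm_deriv hx
  have e (v : E3) : mfderiv (𝓡 3) 𝓘(ℝ, E3) c (c.symm x) (mfderiv 𝓘(ℝ, E3) (𝓡 3) c.symm x v) = v :=
    DFunLike.congr_fun h v
  rw [← e v, ← e w, hvw]

theorem mfderiv_symm_surjective (hc : c ∈ IsManifold.maximalAtlas (𝓡 3) ∞ T) (hx : x ∈ c.target) :
    Function.Surjective (mfderiv 𝓘(ℝ, E3) (𝓡 3) c.symm x) := by
  intro v
  have h := (mdifferentiable_chart hc).symm_comp_deriv (c.map_target hx)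
  rw [c.right_inv hx] at h
  exact ⟨mfderiv (𝓡 3) 𝓘(ℝ, E3) c (c.symm x) v, DFunLike.congr_fun h v⟩

/-- The derivative of a function along a vector, in coordinates. -/
theorem fderiv_comp_symm (hc : c ∈ IsManifold.maximalAtlas (𝓡 3) ∞ T) (hx : x ∈ c.target)
    {ψ : T → ℝ} (hψ : MDifferentiableAt (𝓡 3) 𝓘(ℝ, ℝ) ψ (c.symm x)) (w : E3) :
    fderiv ℝ (ψ ∘ c.symm) x w =
      mfderiv (𝓡 3) 𝓘(ℝ, ℝ) ψ (c.symm x) (mfderiv 𝓘(ℝ, E3) (𝓡 3) c.symm x w) := by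
  have h := mfderiv_comp x hψ (mdifferentiableAt_symm hc hx)
  rw [mfderiv_eq_fderiv] at h
  rw [h]
  rfl

variable [IsManifold (𝓡 3) ∞ T]

theorem contMDiffOn_coordVec (hc : c ∈ IsManifold.maximalAtlas (𝓡 3) ∞ T) (i : Fin 3) :
    ContMDiffOn 𝓘(ℝ, E3) (𝓡 3).tangent ∞
      (fun x ↦ (⟨c.symm x, coordVec c i x⟩ : TangentBundle (𝓡 3) T)) c.target := by
  have h₁ := (contMDiffOn_symm_of_mem_maximalAtlas hc).contMDiffOn_tangentMapWithin
    (m := ∞) (by simp) c.open_target.uniqueMDiffOn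
  have h₂ : ContMDiffOn 𝓘(ℝ, E3) 𝓘(ℝ, E3).tangent ∞ (fun x ↦
      (⟨x, EuclideanSpace.single i (1 : ℝ)⟩ : TangentBundle 𝓘(ℝ, E3) E3)) c.target :=
    contMDiffOn_vectorSpace_iff_contDiffOn.2 contDiffOn_const
  refine (h₁.comp h₂ fun x hx ↦ hx).congr fun x hx ↦ ?_
  simp only [Function.comp_apply, tangentMapWithin, coordVec]
  rw [mfderivWithin_of_isOpen c.open_target hx]

theorem contDiffOn_bilin (hc : c ∈ IsManifold.maximalAtlas (𝓡 3) ∞ T)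
    (h : Bundle.ContMDiffRiemannianMetric (𝓡 3) ∞ E3 (fun p : T ↦ TangentSpace (𝓡 3) p))
    {V W : ∀ x : E3, TangentSpace (𝓡 3) (c.symm x)}
    (hV : ContMDiffOn 𝓘(ℝ, E3) (𝓡 3).tangent ∞
      (fun x ↦ (⟨c.symm x, V x⟩ : TangentBundle (𝓡 3) T)) c.target)
    (hW : ContMDiffOn 𝓘(ℝ, E3) (𝓡 3).tangent ∞
      (fun x ↦ (⟨c.symm x, W x⟩ : TangentBundle (𝓡 3) T)) c.target) :
    ContDiffOn ℝ ∞ (fun x ↦ h.inner (c.symm x) (V x) (W x)) c.target := by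
  rw [← contMDiffOn_iff_contDiffOn]
  intro x hx
  have : ContMDiffWithinAt 𝓘(ℝ, E3) ((𝓡 3).prod 𝓘(ℝ)) ∞
      (fun m ↦ Bundle.TotalSpace.mk' ℝ (E := Bundle.Trivial T ℝ) (c.symm m)
        (h.inner (c.symm m) (V m) (W m))) c.target x := by
    apply ContMDiffWithinAt.clm_bundle_apply₂ (F₁ := E3) (F₂ := E3)
    · exact ContMDiffAt.comp_contMDiffWithinAt x h.contMDiff.contMDiffAt
        (contMDiffOn_symm_of_mem_maximalAtlas hc x hx)
    · exact hV x hx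
    · exact hW x hx
  simp only [Bundle.contMDiffWithinAt_totalSpace] at this
  exact this.2

theorem isLocalMetric_metricMatrix (hc : c ∈ IsManifold.maximalAtlas (𝓡 3) ∞ T)
    (h : Bundle.ContMDiffRiemannianMetric (𝓡 3) ∞ E3 (fun p : T ↦ TangentSpace (𝓡 3) p)) :
    IsLocalMetric c.target (metricMatrix h.inner c) where
  isOpen := c.open_target
  symm x i j := h.symm _ _ _
  smooth i j := contDiffOn_bilin hc h (contMDiffOn_coordVec hc i) (contMDiffOn_coordVec hc j)
  det_ne_zero x hx hdet := by
    -- A kernel vector of the Gram matrix would be a nonzero tangent vector of length zero.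
    obtain ⟨w, hw, hGw⟩ := Matrix.exists_mulVec_eq_zero_iff.2 hdet
    set w' : E3 := WithLp.toLp 2 w with hw'
    have hV : mfderiv 𝓘(ℝ, E3) (𝓡 3) c.symm x w' ≠ 0 := by
      intro h0
      have : w' = 0 := mfderiv_symm_injective hc hx (h0.trans (map_zero _).symm)
      exact hw (by simpa [hw'] using this)
    refine (h.pos _ _ hV).ne' ?_
    rw [mfderiv_symm_eq_sum]
    simp only [map_sum, map_smul, sum_apply, smul_apply, smul_eq_mul]
    refine Finset.sum_eq_zero fun i _ ↦ ?_
    have h₂ := congrFun hGw i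
    simp only [Matrix.mulVec, dotProduct, metricMatrix, Matrix.of_apply, Pi.zero_apply] at h₂
    rw [← mul_zero (w i), ← h₂]
    simp only [Finset.mul_sum]
    refine Finset.sum_congr rfl fun j _ ↦ ?_
    rw [h.symm]
    simp only [hw']
    ring

end Charts

/-! ### The hypersurface as a local model -/

namespace Hypersurface

variable {M : Type*} [TopologicalSpace M] [ChartedSpace E4 M] [IsManifold (𝓡 4) ∞ M]
  {S : Decomposition M}
  {T : Type*} [TopologicalSpace T] [ChartedSpace E3 T] [IsManifold (𝓡 3) ∞ T]
  {c : OpenPartialHomeomorph T E3} {x : E3}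

/-- The covector components of the preferred direction. -/
def eLow (H : Hypersurface S T) (c : OpenPartialHomeomorph T E3) (i : Fin 3) (x : E3) : ℝ :=
  H.h.inner (c.symm x) (H.e (c.symm x)) (coordVec c i x)

theorem inner_e_e (H : Hypersurface S T) (p : T) : H.h.inner p (H.e p) (H.e p) = 1 := by
  rw [H.h_eq, H.e_eq, S.e_unit]

/-- The `u` terms of the sheet metric drop out on vectors tangent to the hypersurface. -/
theorem N_eq (H : Hypersurface S T) (p : T) (v w : TangentSpace (𝓡 3) p) :
    H.N p v w = H.h.inner p v w - H.h.inner p (H.e p) v * H.h.inner p (H.e p) w := by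
  rw [N, Decomposition.N, H.orthogonal_u, H.h_eq, H.h_eq, H.h_eq, H.e_eq]
  ring

theorem contDiffOn_eLow (H : Hypersurface S T) (hc : c ∈ IsManifold.maximalAtlas (𝓡 3) ∞ T)
    (i : Fin 3) : ContDiffOn ℝ ∞ (H.eLow c i) c.target :=
  contDiffOn_bilin hc H.h
    (H.e_smooth.comp_contMDiffOn (contMDiffOn_symm_of_mem_maximalAtlas hc))
    (contMDiffOn_coordVec hc i)

/-- The components of the preferred direction in a chart. -/
theorem exists_components (H : Hypersurface S T) (hc : c ∈ IsManifold.maximalAtlas (𝓡 3) ∞ T)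
    (hx : x ∈ c.target) : ∃ w : E3, mfderiv 𝓘(ℝ, E3) (𝓡 3) c.symm x w = H.e (c.symm x) ∧
      ∀ i, w i = ∑ j, (metricMatrix H.h.inner c x)⁻¹ i j * H.eLow c j x := by
  obtain ⟨(w : E3), hw⟩ := mfderiv_symm_surjective hc hx (H.e (c.symm x))
  refine ⟨w, hw, fun i ↦ ?_⟩
  have hE (j : Fin 3) : H.eLow c j x = ∑ k, w k * metricMatrix H.h.inner c x k j := by
    rw [eLow, ← hw, mfderiv_symm_eq_sum]
    simp only [map_sum, map_smul, sum_apply, smul_apply, smul_eq_mul,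
      metricMatrix, Matrix.of_apply]
  have hG := isLocalMetric_metricMatrix hc H.h
  have e := fun k ↦ hG.sum_inv_mul hx i k
  have : ∑ j, (metricMatrix H.h.inner c x)⁻¹ i j * H.eLow c j x =
      ∑ k, w k * ∑ m, (metricMatrix H.h.inner c x)⁻¹ i m * metricMatrix H.h.inner c x m k := by
    simp only [hE, Fin.sum_univ_three]
    simp only [hG.symm x 1 0, hG.symm x 2 0, hG.symm x 2 1]
    ring
  rw [this]
  simp [e]

theorem hasPartial_hess_of_vanish (H : Hypersurface S T) {φ : T → ℝ}
    (hthird : HigherDerivativesVanish H.h.inner φ)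
    (hc : c ∈ IsManifold.maximalAtlas (𝓡 3) ∞ T) (hx : x ∈ c.target) (d a b : Fin 3) :
    HasPartial d (hessOf (metricMatrix H.h.inner c) (φ ∘ c.symm) a b)
      (∑ m, (gammaOf (metricMatrix H.h.inner c) m d a x *
          hessOf (metricMatrix H.h.inner c) (φ ∘ c.symm) m b x
        + gammaOf (metricMatrix H.h.inner c) m d b x *
          hessOf (metricMatrix H.h.inner c) (φ ∘ c.symm) a m x)) x := by
  obtain ⟨h₁, h₂⟩ := hthird c hc x hx
  have h₃ := h₁ ![a, b]
  rw [iterCovDeriv_two] at h₃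
  refine HasPartial.of_eq (.of_differentiableAt h₃) ?_
  -- The vanishing at order three, with `d` as the new index, is exactly the parallelism of the
  -- Hessian.
  have h₄ := h₂ 3 le_rfl ![d, a, b]
  rw [iterCovDeriv, covDeriv] at h₄
  simp only [iterCovDeriv_two, Fin.sum_univ_two, christoffel_eq_gammaOf] at h₄
  simp [Fin.tail, Function.update] at h₄
  rw [Finset.sum_add_distrib]
  linarith

theorem isLocalModel (H : Hypersurface S T) {α β : T → ℝ} (hRicci : H.HasRicciForm α β)
    {φ : T → ℝ} (hφ : ContMDiff (𝓡 3) 𝓘(ℝ, ℝ) 2 φ)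
    (hsheet : ∀ (p : T) (v : TangentSpace (𝓡 3) p), H.delta φ p v = 0) {C : ℝ}
    (hcurv : HasConstantScalarCurvature (H.conformalMetric φ) C)
    (hthird : HigherDerivativesVanish H.h.inner φ)
    (hc : c ∈ IsManifold.maximalAtlas (𝓡 3) ∞ T) :
    IsLocalModel c.target (metricMatrix H.h.inner c) (φ ∘ c.symm) (H.eLow c)
      (H.hat φ ∘ c.symm) C where
  metric := isLocalMetric_metricMatrix hc H.h
  potential := by
    rw [← contMDiffOn_iff_contDiffOn]
    exact hφ.comp_contMDiffOn ((contMDiffOn_symm_of_mem_maximalAtlas hc).of_le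
      (WithTop.coe_le_coe.2 (le_top : (2 : ℕ∞) ≤ ⊤)))
  parallel x hx d a b := H.hasPartial_hess_of_vanish hthird hc hx d a b
  grad_eq x hx i := by
    rw [partialDeriv, fderiv_comp_symm hc hx (hφ.mdifferentiable (by simp) _)]
    have h₁ := hsheet (c.symm x) (coordVec c i x)
    rw [delta, map_sub, map_smul] at h₁
    exact (sub_eq_zero.1 h₁).trans (mul_comm _ _)
  unit x hx := by
    obtain ⟨w, hw, hwi⟩ := H.exists_components hc hx
    simp only [← hwi]
    have h₁ := H.inner_e_e (c.symm x)
    nth_rw 2 [← hw] at h₁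
    rw [mfderiv_symm_eq_sum] at h₁
    simpa only [map_sum, map_smul, smul_eq_mul, eLow] using h₁
  ricci x hx := by
    refine ⟨α (c.symm x), β (c.symm x), fun i j ↦ ?_⟩
    have h₁ := hRicci c hc x hx i j
    rw [N_eq] at h₁
    exact h₁
  scal x hx := hcurv c hc x hx

theorem hat_hat_nonpos (H : Hypersurface S T) {α β : T → ℝ} (hRicci : H.HasRicciForm α β)
    {φ : T → ℝ} (hφ : ContMDiff (𝓡 3) 𝓘(ℝ, ℝ) 2 φ)
    (hsheet : ∀ (p : T) (v : TangentSpace (𝓡 3) p), H.delta φ p v = 0) {C : ℝ} (hC : 0 ≤ C)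
    (hcurv : HasConstantScalarCurvature (H.conformalMetric φ) C)
    (hthird : HigherDerivativesVanish H.h.inner φ) (p : T) : H.hat (H.hat φ) p ≤ 0 := by
  set c := chartAt E3 p with hcdef
  have hc : c ∈ IsManifold.maximalAtlas (𝓡 3) ∞ T := IsManifold.chart_mem_maximalAtlas p
  have hp : p ∈ c.source := mem_chart_source E3 p
  have hx : c p ∈ c.target := c.map_source hp
  have hm := H.isLocalModel hRicci hφ hsheet hcurv hthird hc
  have key := hm.sum_partialDeriv_coeff_nonpos (H.contDiffOn_eLow hc) hC hx
  obtain ⟨w, hw, hwi⟩ := H.exists_components hc hx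
  -- The chain rule below needs differentiability of the hat derivative on the manifold; it is
  -- carried back from the chart, where the coefficient is `C¹`.
  have hf : MDifferentiableAt (𝓡 3) 𝓘(ℝ, ℝ) (H.hat φ) p := by
    have h₁ : DifferentiableAt ℝ (H.hat φ ∘ c.symm) (c p) :=
      ((hm.contDiffOn_coeff (H.contDiffOn_eLow hc)).contDiffAt
        (c.open_target.mem_nhds hx)).differentiableAt (by simp)
    have h₂ := h₁.mdifferentiableAt.comp p ((mdifferentiable_chart hc).mdifferentiableAt hp)
    refine h₂.congr_of_eventuallyEq ?_
    filter_upwards [c.open_source.mem_nhds hp] with q hq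
    simp [c.left_inv hq]
  have h₃ := fderiv_comp_symm hc hx (ψ := H.hat φ) (by rwa [c.left_inv hp]) w
  rw [clm_apply_eq_sum, hw, c.left_inv hp] at h₃
  simp only [← hwi] at key
  exact h₃.symm.trans_le key

end Hypersurface

end SplitSpacetime

end

theorem corollary1
    {M : Type*} [TopologicalSpace M] [ChartedSpace SplitSpacetime.E4 M] [IsManifold (𝓡 4) ∞ M]
    (S : SplitSpacetime.Decomposition M)
    {T : Type*} [TopologicalSpace T] [ChartedSpace SplitSpacetime.E3 T] [IsManifold (𝓡 3) ∞ T]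
    (H : SplitSpacetime.Hypersurface S T)
    (α β : T → ℝ) (hRicci : H.HasRicciForm α β)
    (φ : T → ℝ) (hφ : ContMDiff (𝓡 3) 𝓘(ℝ, ℝ) 2 φ)
    (hproper : ¬ ∃ k : ℝ, ∀ p : T, φ p = k)
    (hsheet : ∀ (p : T) (v : TangentSpace (𝓡 3) p), H.delta φ p v = 0)
    (C : ℝ) (hC : 0 ≤ C)
    (hcurv : SplitSpacetime.HasConstantScalarCurvature (H.conformalMetric φ) C)
    (hpos : ∀ p : T, 0 < H.hat φ p ^ 2 + 2 * H.hat (H.hat φ) p)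
    (hthird : SplitSpacetime.HigherDerivativesVanish H.h.inner φ) :
    ∀ p : T, H.hat (H.hat φ) p ≤ 0 ∧ |H.hat (H.hat φ) p| < H.hat φ p ^ 2 := by
  intro p
  have h := H.hat_hat_nonpos hRicci hφ hsheet hC hcurv hthird p
  refine ⟨h, ?_⟩
  -- The positivity hypothesis gives `f² > -2 e(f)`, and `-2 e(f) ≥ -e(f)` since `e(f) ≤ 0`.
  rw [abs_of_nonpos h]
  linarith [hpos p]
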